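/- Let $b:\mathbb R^{d_x}\times\mathbb R^{d_y}\to\mathbb R^{d_y}$ and $\sigma:\mathbb R^{d_x}\times\mathbb R^{d_y}\to\mathbb R^{d_y\times d_y}$ be given, put $a=\sigma\sigma^*$, and assume: (i) $a$ and $b$ are continuous in $y$ and $C^2$ in $x$, and they and their $x$-derivatives of order at most $2$ are bounded by $C(1+|y|)$ uniformly in $x$; (ii) $a$ is uniformly continuous, and $\lambda_-I\le a(x,y)\le\lambda_+I$ for some constants $\lambda_-,\lambda_+>0$; (iii) $\sup_x b(x,y)\cdot y\le -c_1|y|^2+c_2$ for some $c_1>0$, $c_2\in\mathbb R$. For each $x$ let $\mu^x$ be the invariant probability measure of the diffusion $dY_t=b(x,Y_t)\,dt+\sigma(x,Y_t)\,d\tilde W_t$, with generator $\mathcal L^x_y=\frac12\sum_{i,j}a_{ij}(x,y)\partial^2_{y_iy_j}+\sum_i b_i(x,y)\partial_{y_i}$. Let $(\gamma_k)_{k\ge0}$ be a decreasing sequence of positive numbers with $\gamma_k\to0$, $\Gamma_k:=\sum_{j=0}^k\gamma_j\to\infty$ and $\sum_{k\ge1}\gamma_k^2/\Gamma_k<\infty$,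 and write $\Gamma_M^{[p]}:=\sum_{k=1}^M\gamma_k^p$. Let $\tilde W^q$, $q\in\mathbb Q$, be standard $d_y$-dimensional Brownian motions, let $\sqrt{\gamma_{k+1}}\,U^q_{k+1}:=\tilde W^q_{\Gamma_{k+1}}-\tilde W^q_{\Gamma_k}$, fix $y_0\in\mathbb R^{d_y}$, and define $$\bar Y^{x,q}_0=y_0,\qquad \bar Y^{x,q}_{k+1}=\bar Y^{x,q}_k+\gamma_{k+1}b(x,\bar Y^{x,q}_k)+\sqrt{\gamma_{k+1}}\,\sigma(x,\bar Y^{x,q}_k)U^q_{k+1}.$$ Let $\psi:\mathbb R^{d_x}\times\mathbb R^{d_y}\to\mathbb R$ satisfy $|\psi(x,y)|\le C(x)(1+|y|^\pi)$ for some function $C$ and some $\pi\ge0$, and put $\bar\Psi(x)=\int\psi(x,z)\,\mu^x(dz)$. Suppose that the centered Poisson equation $\mathcal L^x_y\phi_\psi(x,y)=\psi(x,y)-\bar\Psi(x)$ has a solution $\phi_\psi\in C^{2,r}_{b,p}$ for some integer $r>3$, that is, the derivatives $\partial_x^i\partial_y^j\phi_\psi$ with $0\le i\le2$ and $0\le j\le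 r-i$ exist, are continuous in each variable, and are bounded by $K'(1+|y|^m)$ uniformly in $x$, for some $K'$ and $m$. Let $\alpha\ge1$ be such that $\Gamma^{[\alpha]}_M\to\infty$ as $M\to\infty$. Then there is a constant $K$, which depends neither on $x\in\mathbb R^{d_x}$, nor on $q\in\mathbb Q$, nor on $M$, such that for all $x$, $q$ and $M\ge1$ $$\mathbb E\left[\left|\frac1{\Gamma_M^{[\alpha]}}\sum_{k=1}^M\gamma_k^\alpha\left(\psi(x,\bar Y^{x,q}_{k-1})-\bar\Psi(x)\right)\right|^2\right]\le K\,\frac{1+\Gamma_M^{[2\alpha-1]}+\Gamma_M^{[2\alpha]}+\left(\Gamma_M^{[\alpha+1]}\right)^2}{\left(\Gamma_M^{[\alpha]}\right)^2},$$ the expectation on the left being finite. -/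

import Mathlib

open MeasureTheory ProbabilityTheory Filter Topology
open scoped NNReal

noncomputable section

namespace DecreasingStep

/-- `ℝᵈ` with its Euclidean norm. -/
abbrev Vec (d : ℕ) : Type := EuclideanSpace ℝ (Fin d)

/-- The `i`-th vector of the canonical basis of `ℝᵈ`. -/
def basisVec {d : ℕ} (i : Fin d) : Vec d := EuclideanSpace.single i (1 : ℝ)

/-! ### The frozen fast diffusion -/

/-- The second order operator
`f ↦ (1/2) ∑ᵢⱼ aᵢⱼ(y) ∂²f/∂yᵢ∂yⱼ (y) + ∑ᵢ bᵢ(y) ∂f/∂yᵢ (y)`. -/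
def generator {d : ℕ} (b : Vec d → Vec d) (a : Vec d → Matrix (Fin d) (Fin d) ℝ)
    (f : Vec d → ℝ) (y : Vec d) : ℝ :=
  (1 / 2) * (∑ i, ∑ j, a y i j * iteratedFDeriv ℝ 2 f y ![basisVec i, basisVec j])
    + ∑ i, b y i * fderiv ℝ f y (basisVec i)

/-- The diffusion matrix `a = σ σ*`. -/
def diffusionMatrix {dx dy : ℕ} (σ : Vec dx → Vec dy → Matrix (Fin dy) (Fin dy) ℝ)
    (x : Vec dx) (y : Vec dy) : Matrix (Fin dy) (Fin dy) ℝ :=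
  σ x y * (σ x y).transpose

/-- `Y` is, under `P`, a weak solution of the stochastic differential equation with drift `b` and
diffusion matrix `a`, in the sense of the Stroock-Varadhan martingale problem: `Y` is adapted with
continuous paths, and `f(Y_t) - f(Y_0) - ∫₀ᵗ (L f)(Y_s) ds` is a martingale for each smooth
compactly supported `f`, where `L` is the generator. -/
structure SolvesMartingaleProblem {d : ℕ} (b : Vec d → Vec d)
    (a : Vec d → Matrix (Fin d) (Fin d) ℝ) {Ω : Type} {mΩ : MeasurableSpace Ω}
    (𝓕 : Filtration ℝ≥0 mΩ) (Y : ℝ≥0 → Ω → Vec d) (P : Measure Ω) : Prop where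
  adapted : StronglyAdapted 𝓕 Y
  continuous_paths : ∀ ω, Continuous fun t => Y t ω
  martingale : ∀ f : Vec d → ℝ, ContDiff ℝ (⊤ : ℕ∞) f → HasCompactSupport f →
    Martingale (fun (t : ℝ≥0) ω => f (Y t ω) - f (Y 0 ω)
      - ∫ s in (0 : ℝ)..(t : ℝ), generator b a f (Y s.toNNReal ω)) 𝓕 P

/-- `μ` is an invariant probability measure of the diffusion with drift `b` and diffusion matrix
`a`: the diffusion started with law `μ` has law `μ` at all times. -/
def IsInvariantMeasure {d : ℕ} (b : Vec d → Vec d) (a : Vec d → Matrix (Fin d) (Fin d) ℝ)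
    (μ : Measure (Vec d)) : Prop :=
  IsProbabilityMeasure μ ∧
    ∃ (Ω : Type) (mΩ : MeasurableSpace Ω) (P : Measure Ω) (𝓕 : Filtration ℝ≥0 mΩ)
      (Y : ℝ≥0 → Ω → Vec d), IsProbabilityMeasure P ∧ SolvesMartingaleProblem b a 𝓕 Y P ∧
        ∀ t, HasLaw (Y t) μ P

/-! ### Function classes and the hypothesis on the fast scale -/

/-- The class `C^{2,0}_{b,l}`: continuous in `y`, twice continuously differentiable in `x`, the
function and its `x`-derivatives being bounded in `x` and at most linearly growing in `y`. -/
def ClassC20bl {dx dy : ℕ} {G : Type} [NormedAddCommGroup G] [NormedSpace ℝ G]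
    (u : Vec dx → Vec dy → G) : Prop :=
  (∀ x, Continuous (u x)) ∧ (∀ y, ContDiff ℝ 2 fun x => u x y) ∧
    ∃ K : ℝ, ∀ i ≤ 2, ∀ x y, ‖iteratedFDeriv ℝ i (fun x' => u x' y) x‖ ≤ K * (1 + ‖y‖)

/-- The class `C^{2,r}_{b,p}`: the derivatives `∂ₓⁱ ∂_yʲ u`, `i ≤ 2`, `j ≤ r - i`, exist, are
bounded in `x` and at most polynomially growing in `y`. -/
def ClassC2rbp {dx dy : ℕ} (r : ℕ) (u : Vec dx → Vec dy → ℝ) : Prop :=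
  (∀ x, ContDiff ℝ r (u x)) ∧
    (∀ i j, i ≤ 2 → i + j ≤ r → ∀ y, ContDiff ℝ i fun x => iteratedFDeriv ℝ j (u x) y) ∧
    ∃ (K : ℝ) (m : ℕ), ∀ i j, i ≤ 2 → i + j ≤ r → ∀ x y,
      ‖iteratedFDeriv ℝ i (fun x' => iteratedFDeriv ℝ j (u x') y) x‖ ≤ K * (1 + ‖y‖ ^ m)

/-- The standing hypothesis on the fast-scale coefficients. -/
structure FastScaleHypothesis {dx dy : ℕ} (b : Vec dx → Vec dy → Vec dy)
    (σ : Vec dx → Vec dy → Matrix (Fin dy) (Fin dy) ℝ) : Prop where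
  measurable_sigma : ∀ x i j, Measurable fun y => σ x y i j
  regular_drift : ClassC20bl b
  regular_diffusion : ∀ i j, ClassC20bl fun x y => diffusionMatrix σ x y i j
  uniformContinuous : ∀ i j,
    UniformContinuous fun p : Vec dx × Vec dy => diffusionMatrix σ p.1 p.2 i j
  elliptic : ∃ lo hi : ℝ, 0 < lo ∧ 0 < hi ∧ ∀ x y,
    (diffusionMatrix σ x y - lo • (1 : Matrix (Fin dy) (Fin dy) ℝ)).PosSemidef ∧
    (hi • (1 : Matrix (Fin dy) (Fin dy) ℝ) - diffusionMatrix σ x y).PosSemidef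
  recurrent : ∃ c₁ c₂ : ℝ, 0 < c₁ ∧ ∀ x y, inner ℝ (b x y) y ≤ -c₁ * ‖y‖ ^ 2 + c₂

/-! ### The step sequence -/

/-- `Γ_k = γ_0 + ⋯ + γ_k`. -/
def cumStep (γ : ℕ → ℝ) (k : ℕ) : ℝ := ∑ j ∈ Finset.range (k + 1), γ j

/-- `Γ_M^{[p]} = γ_1^p + ⋯ + γ_M^p`. -/
def powSum (γ : ℕ → ℝ) (p : ℝ) (M : ℕ) : ℝ := ∑ k ∈ Finset.Icc 1 M, γ k ^ p

/-- The hypothesis on the sequence of steps. -/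
structure StepHypothesis (γ : ℕ → ℝ) : Prop where
  pos : ∀ k, 0 < γ k
  decreasing : Antitone γ
  tendsto_zero : Tendsto γ atTop (𝓝 0)
  divergent : Tendsto (cumStep γ) atTop atTop
  summable : Summable fun k : ℕ => γ (k + 1) ^ 2 / cumStep γ (k + 1)

/-! ### The decreasing step Euler scheme -/

/-- `W` is a standard `d`-dimensional Brownian motion under `P`. -/
structure IsBrownianMotion {d : ℕ} {Ω : Type*} {mΩ : MeasurableSpace Ω}
    (W : ℝ≥0 → Ω → Vec d) (P : Measure Ω) : Prop where
  zero : ∀ᵐ ω ∂P, W 0 ω = 0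
  indep : HasIndepIncrements W P
  law : ∀ s t : ℝ≥0, s ≤ t → HasLaw (fun ω => W t ω - W s ω)
    ((stdGaussian (Vec d)).map fun z => √((t : ℝ) - s) • z) P
  continuous_paths : ∀ᵐ ω ∂P, Continuous fun t => W t ω

/-- The normalised increment `U_{k+1}`, given by
`√γ_{k+1} U_{k+1} = W_{Γ_{k+1}} - W_{Γ_k}`. -/
def noise {d : ℕ} {Ω : Type*} (γ : ℕ → ℝ) (W : ℝ≥0 → Ω → Vec d) (k : ℕ) (ω : Ω) : Vec d :=
  (√(γ (k + 1)))⁻¹ • (W (cumStep γ (k + 1)).toNNReal ω - W (cumStep γ k).toNNReal ω)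

/-- The decreasing step Euler scheme `Ȳ_k` for drift `b` and diffusion coefficient `σ`, driven by
`W` and started at `y₀`. -/
def euler {d : ℕ} {Ω : Type*} (b : Vec d → Vec d) (σ : Vec d → Matrix (Fin d) (Fin d) ℝ)
    (γ : ℕ → ℝ) (W : ℝ≥0 → Ω → Vec d) (y₀ : Vec d) : ℕ → Ω → Vec d
  | 0, _ => y₀
  | k + 1, ω =>
    euler b σ γ W y₀ k ω + γ (k + 1) • b (euler b σ γ W y₀ k ω)
      + √(γ (k + 1)) • Matrix.toEuclideanLin (σ (euler b σ γ W y₀ k ω)) (noise γ W k ω)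

end DecreasingStep

end

open DecreasingStep

/-! The Poisson equation replaces `ψ x - Ψ̄(x)` by `L f`, with `f = φ x`, so only the weighted sums
of `L f` along the scheme have to be controlled. Write `Y k` for the scheme, `w k = γ_{k+1}^(α-1)`,
`T k = f (Y (k+1)) - f (Y k)`, and `R k` for the mean of `T k` over the Gaussian noise with `Y k`
held fixed. Then `γ_{k+1}^α L f (Y k) = w k T k - w k (T k - R k) - w k (R k - γ_{k+1} L f (Y k))`,
and each of the three sums produces one term of the bound.

The first sum telescopes up to summation by parts. Since `α ≥ 1` the weights decrease, so its second
moment is bounded independently of `M` (`SqBound.weighted_increments`). The second is a sum of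
martingale increments of variance `O(w² γ)`; by orthogonality its second moment is `O(Γ^[2α-1])`
(`IsGaussianNoise.sqBound_martingale_sum`). In the third, the local weak error is `O(γ²)`
(`PolyDeriv.abs_weak_error_le`), and Cauchy–Schwarz gives `O((Γ^[α+1])²)` (`SqBound.weighted_sum`).

All error terms grow polynomially in `|Y k|`, so moments of the scheme bounded uniformly in `k` are
needed. They come from the Lyapunov function `1 + |y|²`: dissipativity of the drift contracts its
powers once the steps are small (`exists_lyap_contraction`), and the finitely many earlier steps
cost a constant factor (`exists_moment_bound`).

Uniformity in `x` and `q` is obtained by fixing every constant before the coefficients, the noise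
and the test function: the constants see these only through the growth bounds `B`, `S`, `K`, `m` and
the dissipativity constants `c₁`, `c₂`. -/

namespace DecreasingStep

/-! ### Taylor expansions along segments. -/

section Taylor

variable {E : Type*} [NormedAddCommGroup E] [NormedSpace ℝ E]

/-- The iterated derivatives of a function along a line. -/
lemma iteratedDeriv_comp_line {f : E → ℝ} {n : ℕ} (hf : ContDiff ℝ n f) (w h : E) (t : ℝ) :
    iteratedDeriv n (fun t : ℝ => f (w + t • h)) t
      = iteratedFDeriv ℝ n f (w + t • h) fun _ => h := by
  have h1 : ContDiff ℝ n fun z => f (w + z) := hf.comp (contDiff_const.add contDiff_id)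
  have h2 := (ContinuousLinearMap.toSpanSingleton ℝ h).iteratedFDeriv_comp_right h1 t
    (i := n) le_rfl
  rw [iteratedDeriv_eq_iteratedFDeriv]
  have h3 : ((fun z => f (w + z)) ∘ (ContinuousLinearMap.toSpanSingleton ℝ h))
      = fun t : ℝ => f (w + t • h) := by
    ext t; simp
  rw [h3] at h2
  rw [h2, iteratedFDeriv_comp_add_left]
  simp

/-- Taylor's formula with Lagrange remainder along a segment. -/
lemma exists_taylor_segment {f : E → ℝ} {n : ℕ} (hf : ContDiff ℝ (n + 1 : ℕ) f) (w h : E) :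
    ∃ θ ∈ Set.Icc (0 : ℝ) 1, f (w + h) =
      ∑ k ∈ Finset.range (n + 1), iteratedFDeriv ℝ k f w (fun _ => h) / (k.factorial : ℝ)
        + iteratedFDeriv ℝ (n + 1) f (w + θ • h) (fun _ => h) / ((n + 1).factorial : ℝ) := by
  have hline : ContDiff ℝ (n + 1 : ℕ) fun t : ℝ => f (w + t • h) :=
    hf.comp (contDiff_const.add (contDiff_id.smul contDiff_const))
  have h01 : (0 : ℝ) ≠ 1 := zero_ne_one
  obtain ⟨θ, hθ, he⟩ := taylor_mean_remainder_lagrange_iteratedDeriv (n := n) h01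
    (hline.contDiffOn.of_le (by norm_cast))
  rw [Set.uIoo_of_lt one_pos] at hθ
  refine ⟨θ, ⟨hθ.1.le, hθ.2.le⟩, ?_⟩
  rw [iteratedDeriv_comp_line hf, taylor_within_apply] at he
  have hsum : ∀ k ∈ Finset.range (n + 1), ((k.factorial : ℝ)⁻¹ * (1 - 0) ^ k) •
      iteratedDerivWithin k (fun t : ℝ => f (w + t • h)) (Set.uIcc 0 1) 0
      = iteratedFDeriv ℝ k f w (fun _ => h) / (k.factorial : ℝ) := by
    intro k hk
    have hk' : k ≤ n + 1 := (Finset.mem_range.1 hk).le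
    have hk2 : ((k : ℕ) : WithTop ℕ∞) ≤ ((n + 1 : ℕ) : WithTop ℕ∞) := by exact_mod_cast hk'
    rw [iteratedDerivWithin_eq_iteratedDeriv (uniqueDiffOn_uIcc h01)
      (hline.of_le hk2).contDiffAt (by simp),
      iteratedDeriv_comp_line (hf.of_le hk2)]
    simp [div_eq_inv_mul]
  rw [Finset.sum_congr rfl hsum] at he
  simp only [one_smul, sub_zero, one_pow, mul_one] at he
  linarith

lemma iteratedFDeriv_smul_diag (f : E → ℝ) (n : ℕ) (w h : E) (c : ℝ) :
    iteratedFDeriv ℝ n f w (fun _ => c • h) = c ^ n * iteratedFDeriv ℝ n f w fun _ => h := by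
  have := (iteratedFDeriv ℝ n f w).map_smul_univ (fun _ => c) (fun _ => h)
  simpa using this

lemma abs_iteratedFDeriv_diag_le (f : E → ℝ) (n : ℕ) (w h : E) :
    |iteratedFDeriv ℝ n f w fun _ => h| ≤ ‖iteratedFDeriv ℝ n f w‖ * ‖h‖ ^ n := by
  simpa using (iteratedFDeriv ℝ n f w).le_opNorm fun _ => h

/-- Symmetric second difference against the second derivative. -/
lemma abs_symm_diff_sub_le {f : E → ℝ} (hf : ContDiff ℝ 4 f) (w h : E) {Q : ℝ}
    (hQ : ∀ θ ∈ Set.Icc (-1 : ℝ) 1, ‖iteratedFDeriv ℝ 4 f (w + θ • h)‖ ≤ Q) :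
    |f (w + h) + f (w - h) - 2 * f w - iteratedFDeriv ℝ 2 f w fun _ => h| ≤ Q * ‖h‖ ^ 4 / 12 := by
  -- Expanding to third order at `h` and at `-h` cancels the odd terms; what remains beyond the
  -- second derivative is two Lagrange remainders of size `Q ‖h‖ ^ 4 / 24`.
  obtain ⟨θ, hθ, h1⟩ := exists_taylor_segment (n := 3) (by exact_mod_cast hf) w h
  obtain ⟨θ', hθ', h2⟩ := exists_taylor_segment (n := 3) (by exact_mod_cast hf) w ((-1 : ℝ) • h)
  have b1 := abs_iteratedFDeriv_diag_le f 4 (w + θ • h) h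
  have b2 := abs_iteratedFDeriv_diag_le f 4 (w + θ' • (-1 : ℝ) • h) h
  have q1 := hQ θ ⟨by linarith [hθ.1], hθ.2⟩
  have q2 := hQ (-θ') ⟨by linarith [hθ'.2], by linarith [hθ'.1]⟩
  rw [show w + (-θ') • h = w + θ' • (-1 : ℝ) • h by rw [smul_smul]; simp] at q2
  have c1 := b1.trans (mul_le_mul_of_nonneg_right q1 (by positivity))
  have c2 := b2.trans (mul_le_mul_of_nonneg_right q2 (by positivity))
  simp only [iteratedFDeriv_smul_diag, Finset.sum_range_succ, Finset.sum_range_zero,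
    iteratedFDeriv_zero_apply] at h1 h2
  rw [neg_one_smul, ← sub_eq_add_neg] at h2
  rw [neg_one_smul] at c2
  rw [h1, h2, abs_le]
  rw [abs_le] at c1 c2
  norm_num [Nat.factorial] at c1 c2 ⊢
  constructor <;> linarith [c1.1, c1.2, c2.1, c2.2]

lemma abs_sub_le_of_fderiv_segment {f : E → ℝ} (hf : ContDiff ℝ 1 f) (y h : E) {Q : ℝ}
    (hQ : ∀ θ ∈ Set.Icc (0 : ℝ) 1, ‖iteratedFDeriv ℝ 1 f (y + θ • h)‖ ≤ Q) :
    |f (y + h) - f y| ≤ Q * ‖h‖ := by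
  obtain ⟨θ, hθ, h1⟩ := exists_taylor_segment (n := 0) (by exact_mod_cast hf) y h
  have b1 := abs_iteratedFDeriv_diag_le f 1 (y + θ • h) h
  have c1 := b1.trans (mul_le_mul_of_nonneg_right (hQ θ hθ) (by positivity))
  simp only [Finset.sum_range_succ, Finset.sum_range_zero, iteratedFDeriv_zero_apply] at h1
  rw [h1]
  simpa using c1

lemma abs_sub_sub_fderiv_le {f : E → ℝ} (hf : ContDiff ℝ 2 f) (y h : E) {Q : ℝ}
    (hQ : ∀ θ ∈ Set.Icc (0 : ℝ) 1, ‖iteratedFDeriv ℝ 2 f (y + θ • h)‖ ≤ Q) :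
    |f (y + h) - f y - fderiv ℝ f y h| ≤ Q * ‖h‖ ^ 2 / 2 := by
  obtain ⟨θ, hθ, h1⟩ := exists_taylor_segment (n := 1) (by exact_mod_cast hf) y h
  have b1 := abs_iteratedFDeriv_diag_le f 2 (y + θ • h) h
  have c1 := b1.trans (mul_le_mul_of_nonneg_right (hQ θ hθ) (by positivity))
  simp only [Finset.sum_range_succ, Finset.sum_range_zero, iteratedFDeriv_zero_apply,
    iteratedFDeriv_one_apply] at h1
  have h2 : f (y + h) - f y - fderiv ℝ f y h
      = iteratedFDeriv ℝ 2 f (y + θ • h) (fun _ => h) / 2 := by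
    rw [h1]
    norm_num [Nat.factorial]
    ring
  rw [h2, abs_div, abs_two]
  gcongr

lemma norm_iteratedFDeriv_two_sub_le {f : E → ℝ} (hf : ContDiff ℝ 3 f) (y h : E) {Q : ℝ}
    (hQ : ∀ θ ∈ Set.Icc (0 : ℝ) 1, ‖iteratedFDeriv ℝ 3 f (y + θ • h)‖ ≤ Q) :
    ‖iteratedFDeriv ℝ 2 f (y + h) - iteratedFDeriv ℝ 2 f y‖ ≤ Q * ‖h‖ := by
  have hd : Differentiable ℝ (iteratedFDeriv ℝ 2 f) :=
    hf.differentiable_iteratedFDeriv (by norm_num)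
  have := (convex_segment (𝕜 := ℝ) y (y + h)).norm_image_sub_le_of_norm_fderiv_le (𝕜 := ℝ)
    (f := iteratedFDeriv ℝ 2 f) (C := Q) (fun z _ => hd z) (fun z hz => by
      rw [norm_fderiv_iteratedFDeriv]
      rw [segment_eq_image'] at hz
      obtain ⟨θ, hθ, rfl⟩ := hz
      simpa using hQ θ hθ) (left_mem_segment ℝ _ _) (right_mem_segment ℝ _ _)
  simpa using this

end Taylor

/-! ### Deterministic expansion of one step, with polynomial weights. -/

/-- The derivatives of `f` of order at most four grow at most like `K (1 + ‖y‖) ^ m`. -/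
structure PolyDeriv {E : Type*} [NormedAddCommGroup E] [NormedSpace ℝ E] (K : ℝ) (m : ℕ)
    (f : E → ℝ) : Prop where
  contDiff : ContDiff ℝ 4 f
  bound : ∀ j ≤ 4, ∀ y, ‖iteratedFDeriv ℝ j f y‖ ≤ K * (1 + ‖y‖) ^ m

section OneStep

variable {E : Type*} [NormedAddCommGroup E] [NormedSpace ℝ E]

/-- The weight is the product `(1 + ‖y‖) * (1 + ‖u‖)` rather than a sum: its powers factor into a
function of the state and a function of the noise, which can later be integrated separately. -/
lemma PolyDeriv.bound_near {K : ℝ} {m : ℕ} {f : E → ℝ} (hf : PolyDeriv K m f) (hK : 0 ≤ K)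
    {c : ℝ} {y p u : E} (hp : ‖p - y‖ ≤ c * ((1 + ‖y‖) * (1 + ‖u‖))) {j : ℕ}
    (hj : j ≤ 4) :
    ‖iteratedFDeriv ℝ j f p‖ ≤ K * ((1 + c) * ((1 + ‖y‖) * (1 + ‖u‖))) ^ m := by
  refine (hf.bound j hj p).trans ?_
  gcongr
  have h1 : ‖p‖ ≤ ‖p - y‖ + ‖y‖ := by simpa using norm_add_le (p - y) y
  nlinarith [norm_nonneg y, norm_nonneg u, mul_nonneg (norm_nonneg y) (norm_nonneg u)]

/-- Size of a step of the scheme. -/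
lemma norm_step_le {B S g γ θ : ℝ} (hB : 0 ≤ B) (hS : 0 ≤ S) (hγ : 0 ≤ γ) (hγg : γ ≤ g)
    {y v s u : E} (hv : ‖v‖ ≤ B * (1 + ‖y‖)) (hs : ‖s‖ ≤ S * ‖u‖) (hθ : |θ| ≤ 1) :
    ‖γ • v + θ • √γ • s‖ ≤ √γ * ((√g * B + S) * ((1 + ‖y‖) * (1 + ‖u‖))) := by
  have hγ2 : γ = √γ * √γ := (Real.mul_self_sqrt hγ).symm
  have hsq : √γ ≤ √g := Real.sqrt_le_sqrt hγg
  have hu := norm_nonneg u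
  have hy := norm_nonneg y
  calc ‖γ • v + θ • √γ • s‖ ≤ ‖γ • v‖ + ‖θ • √γ • s‖ := norm_add_le _ _
    _ = √γ * (√γ * ‖v‖) + |θ| * (√γ * ‖s‖) := by
        rw [norm_smul, norm_smul, norm_smul, Real.norm_of_nonneg hγ,
          Real.norm_of_nonneg (Real.sqrt_nonneg _), Real.norm_eq_abs]
        nth_rewrite 1 [hγ2]
        ring
    _ ≤ √γ * (√g * (B * (1 + ‖y‖))) + 1 * (√γ * (S * ‖u‖)) := by gcongr
    _ = √γ * (√g * B * (1 + ‖y‖) * 1 + S * (1 * ‖u‖)) := by ring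
    _ ≤ √γ * (√g * B * (1 + ‖y‖) * (1 + ‖u‖) + S * ((1 + ‖y‖) * (1 + ‖u‖))) := by
        gcongr <;> linarith
    _ = _ := by ring

variable {K B S g γ : ℝ} {m : ℕ} {f : E → ℝ} {y v s u : E}

/-- Covers every intermediate point of the Taylor expansions: `θ` scales the noise alone (`θ = 0`
gives the pure drift step) and `θ'` scales the whole displacement. -/
lemma norm_step_le' (hB : 0 ≤ B) (hS : 0 ≤ S) (hγ : 0 ≤ γ) (hγg : γ ≤ g)
    (hv : ‖v‖ ≤ B * (1 + ‖y‖)) (hs : ‖s‖ ≤ S * ‖u‖) {θ θ' : ℝ} (hθ : |θ| ≤ 1)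
    (hθ' : θ' ∈ Set.Icc (0 : ℝ) 1) :
    ‖θ' • (γ • v + θ • √γ • s)‖ ≤ √g * (√g * B + S) * ((1 + ‖y‖) * (1 + ‖u‖)) := by
  rw [norm_smul, Real.norm_of_nonneg hθ'.1, mul_assoc]
  have := norm_step_le hB hS hγ hγg hv hs hθ
  have hsq : √γ ≤ √g := Real.sqrt_le_sqrt hγg
  calc θ' * ‖γ • v + θ • √γ • s‖ ≤ 1 * ‖γ • v + θ • √γ • s‖ := by gcongr; exact hθ'.2
    _ ≤ √γ * ((√g * B + S) * ((1 + ‖y‖) * (1 + ‖u‖))) := by rw [one_mul]; exact this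
    _ ≤ _ := by gcongr

/-- Increment of a function along one step of the scheme. -/
lemma PolyDeriv.abs_step_sub_le (hf : PolyDeriv K m f) (hK : 0 ≤ K) (hB : 0 ≤ B) (hS : 0 ≤ S)
    (hγ : 0 ≤ γ) (hγg : γ ≤ g) (hv : ‖v‖ ≤ B * (1 + ‖y‖)) (hs : ‖s‖ ≤ S * ‖u‖) :
    |f (y + γ • v + √γ • s) - f y| ≤ √γ * (K * (1 + √g * (√g * B + S)) ^ m * (√g * B + S)
      * ((1 + ‖y‖) * (1 + ‖u‖)) ^ (m + 1)) := by
  have h1 : |(1 : ℝ)| ≤ 1 := by simp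
  have hstep := norm_step_le hB hS hγ hγg hv hs h1
  have key := abs_sub_le_of_fderiv_segment (hf.contDiff.of_le (by norm_num)) y
    (γ • v + (1 : ℝ) • √γ • s)
    (fun θ hθ => hf.bound_near hK (c := √g * (√g * B + S)) (u := u) (y := y)
      (by simpa using norm_step_le' hB hS hγ hγg hv hs h1 hθ) (by norm_num))
  rw [one_smul, ← add_assoc] at key
  refine key.trans ?_
  rw [one_smul] at hstep
  refine (mul_le_mul_of_nonneg_left hstep (by positivity)).trans (le_of_eq ?_)
  rw [mul_pow]
  ring

/-- Pointwise second order expansion of the symmetrised step. -/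
lemma PolyDeriv.abs_symm_step_sub_le (hf : PolyDeriv K m f) (hK : 0 ≤ K) (hB : 0 ≤ B)
    (hS : 0 ≤ S) (hγ : 0 ≤ γ) (hγg : γ ≤ g) (hv : ‖v‖ ≤ B * (1 + ‖y‖)) (hs : ‖s‖ ≤ S * ‖u‖) :
    |(f (y + γ • v + √γ • s) + f (y + γ • v - √γ • s)) / 2 - f y - γ * fderiv ℝ f y v
      - γ / 2 * iteratedFDeriv ℝ 2 f y fun _ => s| ≤
    γ ^ 2 * ((S ^ 4 + B ^ 2 + B * S ^ 2) * (K * (1 + √g * (√g * B + S)) ^ m)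
      * ((1 + ‖y‖) * (1 + ‖u‖)) ^ (m + 4)) := by
  set c := √g * (√g * B + S)
  have hc0 : 0 ≤ c := by positivity
  set Z := (1 + ‖y‖) * (1 + ‖u‖) with hZ
  -- `Q` is a common bound for the derivatives of order at most four at all the intermediate points.
  obtain ⟨Q, hQ⟩ : ∃ Q, Q = K * ((1 + c) * Z) ^ m := ⟨_, rfl⟩
  have hy := norm_nonneg y
  have hu := norm_nonneg u
  have hZy : 1 + ‖y‖ ≤ Z := by rw [hZ]; nlinarith
  have hZu : ‖u‖ ≤ Z := by rw [hZ]; nlinarith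
  have hZ1 : 1 ≤ Z := by linarith
  have hZ0 : 0 ≤ Z := by linarith
  have hQ0 : 0 ≤ Q := by rw [hQ]; positivity
  have hsZ : ‖s‖ ≤ S * Z := hs.trans (by gcongr)
  have hvZ : ‖v‖ ≤ B * Z := hv.trans (by gcongr)
  have hγ2 : √γ ^ 2 = γ := Real.sq_sqrt hγ
  -- Three errors, all of order `γ ^ 2`: `t1` is the fourth-order remainder in the noise `√γ s`
  -- around the drifted point, `t2` the second-order remainder in the drift `γ v`, and `t4` the cost
  -- `γ * γ` of moving the second derivative back from `y + γ v` to `y`.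
  have t1 := abs_symm_diff_sub_le hf.contDiff (y + γ • v) (√γ • s) (Q := Q) (fun θ hθ =>
    (hf.bound_near hK (u := u) (y := y) (by
      have := norm_step_le' hB hS hγ hγg hv hs (abs_le.2 hθ) (θ' := 1) (by simp)
      rw [one_smul] at this
      convert! this using 2
      abel) (by norm_num)).trans_eq hQ.symm)
  have h0 : |(0 : ℝ)| ≤ 1 := by simp
  have hnear : ∀ θ ∈ Set.Icc (0 : ℝ) 1, ‖y + θ • γ • v - y‖ ≤ c * Z := fun θ hθ => by
    simpa using norm_step_le' hB hS hγ hγg hv hs h0 hθ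
  have t2 := abs_sub_sub_fderiv_le (hf.contDiff.of_le (by norm_num)) y (γ • v) (Q := Q)
    (fun θ hθ => (hf.bound_near hK (hnear θ hθ) (by norm_num)).trans_eq hQ.symm)
  have t3 := norm_iteratedFDeriv_two_sub_le (hf.contDiff.of_le (by norm_num)) y (γ • v) (Q := Q)
    (fun θ hθ => (hf.bound_near hK (hnear θ hθ) (by norm_num)).trans_eq hQ.symm)
  have t4 : |iteratedFDeriv ℝ 2 f (y + γ • v) (fun _ => s) - iteratedFDeriv ℝ 2 f y fun _ => s|
      ≤ Q * ‖γ • v‖ * ‖s‖ ^ 2 := by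
    have := ((iteratedFDeriv ℝ 2 f (y + γ • v) - iteratedFDeriv ℝ 2 f y).le_opNorm
      fun _ => s).trans (mul_le_mul_of_nonneg_right t3 (by positivity))
    simpa using this
  rw [iteratedFDeriv_smul_diag, hγ2, norm_smul, Real.norm_of_nonneg (Real.sqrt_nonneg _)] at t1
  rw [map_smul, smul_eq_mul, norm_smul, Real.norm_of_nonneg hγ] at t2
  rw [norm_smul, Real.norm_of_nonneg hγ] at t4
  have hZ24 : Z ^ 2 ≤ Z ^ 4 := pow_le_pow_right₀ hZ1 (by norm_num)
  have hZ34 : Z ^ 3 ≤ Z ^ 4 := pow_le_pow_right₀ hZ1 (by norm_num)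
  have e1 : Q * (√γ * ‖s‖) ^ 4 / 12 ≤ γ ^ 2 * (S ^ 4 * Q * Z ^ 4) := by
    have h4 : √γ ^ 4 = γ ^ 2 := by rw [← hγ2]; ring_nf; rw [hγ2]
    have : Q * (√γ * ‖s‖) ^ 4 ≤ Q * (√γ * (S * Z)) ^ 4 := by gcongr
    rw [mul_pow √γ (S * Z), h4] at this
    have h5 : 0 ≤ Q * (γ ^ 2 * (S * Z) ^ 4) := by positivity
    calc _ ≤ Q * (γ ^ 2 * (S * Z) ^ 4) := by linarith
      _ = _ := by ring
  have e2 : Q * (γ * ‖v‖) ^ 2 / 2 ≤ γ ^ 2 * (B ^ 2 * Q * Z ^ 4) := by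
    calc _ ≤ Q * (γ * (B * Z)) ^ 2 := by
            have : Q * (γ * ‖v‖) ^ 2 ≤ Q * (γ * (B * Z)) ^ 2 := by gcongr
            have h5 : 0 ≤ Q * (γ * (B * Z)) ^ 2 := by positivity
            linarith
      _ = γ ^ 2 * (B ^ 2 * Q * Z ^ 2) := by ring
      _ ≤ _ := by gcongr
  have e3 : γ / 2 * (Q * (γ * ‖v‖) * ‖s‖ ^ 2) ≤ γ ^ 2 * (B * S ^ 2 * Q * Z ^ 4) := by
    calc _ ≤ γ * (Q * (γ * (B * Z)) * (S * Z) ^ 2) := by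
            gcongr
            linarith
      _ = γ ^ 2 * (B * S ^ 2 * Q * Z ^ 3) := by ring
      _ ≤ _ := by gcongr
  have t4' := mul_le_mul_of_nonneg_left t4 (show 0 ≤ γ / 2 by positivity)
  rw [← abs_of_nonneg (show 0 ≤ γ / 2 by positivity), ← abs_mul,
    abs_of_nonneg (show 0 ≤ γ / 2 by positivity)] at t4'
  have fin : γ ^ 2 * ((S ^ 4 + B ^ 2 + B * S ^ 2) * (K * (1 + c) ^ m) * Z ^ (m + 4))
      = γ ^ 2 * (S ^ 4 * Q * Z ^ 4) + γ ^ 2 * (B ^ 2 * Q * Z ^ 4)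
        + γ ^ 2 * (B * S ^ 2 * Q * Z ^ 4) := by
    rw [hQ, mul_pow (1 + c)]; ring
  rw [fin]
  have t1' := t1.trans e1
  have t2' := t2.trans e2
  have t4'' := t4'.trans e3
  have hpos : 0 ≤ γ ^ 2 * (S ^ 4 * Q * Z ^ 4) := by positivity
  rw [abs_le] at t1' t2' t4'' ⊢
  constructor <;> linarith [t1'.1, t1'.2, t2'.1, t2'.2, t4''.1, t4''.2]

end OneStep

/-! ### Standard Gaussian integrals. -/

section Gaussian

variable {d : ℕ}

lemma integrable_weight_stdGaussian (n : ℕ) :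
    Integrable (fun u : Vec d => (1 + ‖u‖) ^ n) (stdGaussian (Vec d)) := by
  rcases eq_or_ne n 0 with rfl | hn
  · simp
  have h1 : MemLp (fun u : Vec d => 1 + ‖u‖) (n : ENNReal) (stdGaussian (Vec d)) :=
    (memLp_const (1 : ℝ)).add (IsGaussian.memLp_id _ _ (by simp)).norm
  refine (h1.integrable_norm_pow hn).congr (ae_of_all _ fun u => ?_)
  simp only [Real.norm_eq_abs]
  rw [abs_of_nonneg (by positivity)]

/-- The moments of the standard Gaussian measure. -/
noncomputable def gaussMoment (d n : ℕ) : ℝ :=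
  ∫ u, (1 + ‖u‖) ^ n ∂(stdGaussian (Vec d))

lemma gaussMoment_nonneg (d n : ℕ) : 0 ≤ gaussMoment d n :=
  integral_nonneg fun u => by positivity

lemma integrable_stdGaussian_of_bound {g : Vec d → ℝ}
    (hg : AEStronglyMeasurable g (stdGaussian (Vec d))) {C : ℝ} {n : ℕ}
    (hC : ∀ u, |g u| ≤ C * (1 + ‖u‖) ^ n) : Integrable g (stdGaussian (Vec d)) :=
  ((integrable_weight_stdGaussian n).const_mul C).mono' hg (ae_of_all _ hC)

lemma abs_integral_stdGaussian_le {g : Vec d → ℝ} {C : ℝ} {n : ℕ}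
    (hC : ∀ u, |g u| ≤ C * (1 + ‖u‖) ^ n) :
    |∫ u, g u ∂(stdGaussian (Vec d))| ≤ C * gaussMoment d n := by
  rw [gaussMoment, ← integral_const_mul]
  rw [← Real.norm_eq_abs]
  exact norm_integral_le_of_norm_le ((integrable_weight_stdGaussian n).const_mul C)
    (ae_of_all _ hC)

lemma integral_neg_stdGaussian (g : Vec d → ℝ) :
    ∫ u, g (-u) ∂(stdGaussian (Vec d)) = ∫ u, g u ∂(stdGaussian (Vec d)) := by
  have h : MeasurePreserving (MeasurableEquiv.neg (Vec d)) (stdGaussian (Vec d))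
      (stdGaussian (Vec d)) :=
    ⟨(MeasurableEquiv.neg (Vec d)).measurable,
      stdGaussian_map (LinearIsometryEquiv.neg ℝ (E := Vec d))⟩
  exact h.integral_comp' g

lemma integral_inner_mul_inner_stdGaussian (x y : Vec d) :
    ∫ u, inner ℝ x u * inner ℝ y u ∂(stdGaussian (Vec d)) = inner ℝ x y := by
  have h := covarianceBilin_apply (μ := stdGaussian (Vec d)) (IsGaussian.memLp_id _ 2 (by simp)) x y
  rw [covarianceBilin_stdGaussian] at h
  simpa [innerSL_apply_apply ℝ] using h.symm

lemma integrable_inner_mul_inner_stdGaussian (x y : Vec d) :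
    Integrable (fun u => inner ℝ x u * inner ℝ y u) (stdGaussian (Vec d)) := by
  refine integrable_stdGaussian_of_bound (C := ‖x‖ * ‖y‖) (n := 2)
    (Continuous.aestronglyMeasurable (by fun_prop)) fun u => ?_
  rw [abs_mul]
  calc _ ≤ (‖x‖ * ‖u‖) * (‖y‖ * ‖u‖) := by
        gcongr <;> exact abs_real_inner_le_norm _ _
    _ = ‖x‖ * ‖y‖ * ‖u‖ ^ 2 := by ring
    _ ≤ _ := by gcongr; linarith

lemma toEuclideanLin_apply_eq_inner (A : Matrix (Fin d) (Fin d) ℝ) (u : Vec d) (i : Fin d) :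
    Matrix.toEuclideanLin A u i = inner ℝ (WithLp.toLp 2 (A i) : Vec d) u := by
  change (A.mulVec u.ofLp) i = _
  simp [Matrix.mulVec, dotProduct, PiLp.inner_apply, mul_comm]

lemma eq_sum_basisVec (v : Vec d) : v = ∑ i, v i • basisVec i := by
  have := (EuclideanSpace.basisFun (Fin d) ℝ).sum_repr v
  simpa [basisVec] using this.symm

/-- The expected second derivative in the direction of the noise. -/
lemma integral_iteratedFDeriv_two_stdGaussian (f : Vec d → ℝ) (y : Vec d)
    (A : Matrix (Fin d) (Fin d) ℝ) :
    Integrable (fun u => iteratedFDeriv ℝ 2 f y fun _ => Matrix.toEuclideanLin A u)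
      (stdGaussian (Vec d)) ∧
    ∫ u, iteratedFDeriv ℝ 2 f y (fun _ => Matrix.toEuclideanLin A u) ∂(stdGaussian (Vec d))
      = ∑ i, ∑ j, (A * A.transpose) i j * iteratedFDeriv ℝ 2 f y ![basisVec i, basisVec j] := by
  have hexp : ∀ u, iteratedFDeriv ℝ 2 f y (fun _ => Matrix.toEuclideanLin A u)
      = ∑ i, ∑ j, (inner ℝ (WithLp.toLp 2 (A i) : Vec d) u * inner ℝ (WithLp.toLp 2 (A j)) u)
        * iteratedFDeriv ℝ 2 f y ![basisVec i, basisVec j] := by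
    intro u
    simp only [iteratedFDeriv_two_apply]
    conv_lhs => rw [eq_sum_basisVec (Matrix.toEuclideanLin A u)]
    simp only [map_sum, map_smul, _root_.sum_apply, _root_.smul_apply,
      smul_eq_mul, toEuclideanLin_apply_eq_inner, Matrix.cons_val_zero, Matrix.cons_val_one,
      Finset.mul_sum]
    rw [Finset.sum_comm]
    refine Finset.sum_congr rfl fun i _ => Finset.sum_congr rfl fun j _ => ?_
    ring
  have hint : ∀ i j, Integrable (fun u => (inner ℝ (WithLp.toLp 2 (A i) : Vec d) u
      * inner ℝ (WithLp.toLp 2 (A j)) u) * iteratedFDeriv ℝ 2 f y ![basisVec i, basisVec j])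
      (stdGaussian (Vec d)) := fun i j =>
    (integrable_inner_mul_inner_stdGaussian _ _).mul_const _
  simp only [hexp]
  refine ⟨integrable_finsetSum _ fun i _ => integrable_finsetSum _ fun j _ => hint i j, ?_⟩
  rw [integral_finsetSum _ fun i _ => integrable_finsetSum _ fun j _ => hint i j]
  refine Finset.sum_congr rfl fun i _ => ?_
  rw [integral_finsetSum _ fun j _ => hint i j]
  refine Finset.sum_congr rfl fun j _ => ?_
  rw [integral_mul_const, integral_inner_mul_inner_stdGaussian]
  simp [Matrix.mul_apply, PiLp.inner_apply, mul_comm]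

/-- A bound on `A Aᵀ` bounds the operator norm of `A`. -/
lemma norm_toEuclideanLin_le {A : Matrix (Fin d) (Fin d) ℝ} {c : ℝ}
    (hA : (c • (1 : Matrix (Fin d) (Fin d) ℝ) - A * A.transpose).PosSemidef) (hc : 0 ≤ c)
    (u : Vec d) : ‖Matrix.toEuclideanLin A u‖ ≤ √c * ‖u‖ := by
  set s := Matrix.toEuclideanLin A u with hs
  -- Duality: with `s = A u` and `r = Aᵀ s`, `‖s‖² = ⟪r, u⟫`, while the hypothesis tested on `s`
  -- gives `‖r‖² ≤ c ‖s‖²`.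
  set r : Vec d := WithLp.toLp 2 (A.transpose.mulVec s.ofLp) with hr
  have h1 : inner ℝ s s = inner ℝ r u := by
    have e1 : inner ℝ s s = s.ofLp ⬝ᵥ A.mulVec u.ofLp := by
      rw [EuclideanSpace.inner_eq_star_dotProduct, dotProduct_comm]
      rfl
    rw [e1, Matrix.dotProduct_mulVec, ← Matrix.mulVec_transpose,
      EuclideanSpace.inner_eq_star_dotProduct, dotProduct_comm]
    rfl
  have h2 := hA.dotProduct_mulVec_nonneg s.ofLp
  have h3 : star s.ofLp ⬝ᵥ (c • (1 : Matrix (Fin d) (Fin d) ℝ) - A * A.transpose).mulVec s.ofLp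
      = c * inner ℝ s s - inner ℝ r r := by
    rw [Matrix.sub_mulVec, dotProduct_sub, Matrix.smul_mulVec, Matrix.one_mulVec,
      ← Matrix.mulVec_mulVec, Matrix.dotProduct_mulVec _ A, ← Matrix.mulVec_transpose,
      EuclideanSpace.inner_eq_star_dotProduct, EuclideanSpace.inner_eq_star_dotProduct,
      dotProduct_smul]
    rfl
  rw [h3, real_inner_self_eq_norm_sq, real_inner_self_eq_norm_sq] at h2
  have h4 : ‖s‖ ^ 2 ≤ ‖r‖ * ‖u‖ := by
    rw [← real_inner_self_eq_norm_sq, h1]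
    exact real_inner_le_norm _ _
  have h5 : ‖r‖ ≤ √c * ‖s‖ := by
    rw [← Real.sqrt_sq (norm_nonneg s), ← Real.sqrt_mul hc]
    exact Real.le_sqrt_of_sq_le (by linarith)
  rcases (norm_nonneg s).eq_or_lt with h0 | h0
  · rw [← h0]; positivity
  · have : ‖s‖ * ‖s‖ ≤ (√c * ‖u‖) * ‖s‖ := by
      calc ‖s‖ * ‖s‖ = ‖s‖ ^ 2 := by ring
        _ ≤ ‖r‖ * ‖u‖ := h4
        _ ≤ (√c * ‖s‖) * ‖u‖ := by gcongr
        _ = _ := by ring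
    exact le_of_mul_le_mul_right this h0

end Gaussian

/-! ### Local weak error of the Euler step. -/

section WeakError

variable {d : ℕ}

/-- One step of the Euler scheme from `y` with step `γ` and noise `u`. -/
noncomputable def eulerStep (b : Vec d → Vec d) (σ : Vec d → Matrix (Fin d) (Fin d) ℝ) (γ : ℝ)
    (y u : Vec d) : Vec d :=
  y + γ • b y + √γ • Matrix.toEuclideanLin (σ y) u

/-- Linear growth of the drift and boundedness of the diffusion coefficient. -/
structure CoeffBound (B S : ℝ) (b : Vec d → Vec d) (σ : Vec d → Matrix (Fin d) (Fin d) ℝ) :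
    Prop where
  drift_nonneg : 0 ≤ B
  sigma_nonneg : 0 ≤ S
  drift : ∀ y, ‖b y‖ ≤ B * (1 + ‖y‖)
  sigma : ∀ y u, ‖Matrix.toEuclideanLin (σ y) u‖ ≤ S * ‖u‖

variable {B S g γ K : ℝ} {m : ℕ} {b : Vec d → Vec d} {σ : Vec d → Matrix (Fin d) (Fin d) ℝ}
  {f : Vec d → ℝ}

lemma continuous_eulerStep (b : Vec d → Vec d) (σ : Vec d → Matrix (Fin d) (Fin d) ℝ) (γ : ℝ)
    (y : Vec d) : Continuous (eulerStep b σ γ y) := by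
  have h := LinearMap.continuous_of_finiteDimensional (Matrix.toEuclideanLin (σ y))
  unfold eulerStep
  fun_prop

lemma PolyDeriv.abs_le (hf : PolyDeriv K m f) (y : Vec d) : |f y| ≤ K * (1 + ‖y‖) ^ m := by
  simpa using hf.bound 0 (by norm_num) y

lemma PolyDeriv.abs_eulerStep_sub_le (hf : PolyDeriv K m f) (hK : 0 ≤ K)
    (hbσ : CoeffBound B S b σ) (hγ : 0 ≤ γ) (hγg : γ ≤ g) (y u : Vec d) :
    |f (eulerStep b σ γ y u) - f y| ≤ √γ * (K * (1 + √g * (√g * B + S)) ^ m * (√g * B + S)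
      * ((1 + ‖y‖) * (1 + ‖u‖)) ^ (m + 1)) :=
  hf.abs_step_sub_le hK hbσ.drift_nonneg hbσ.sigma_nonneg hγ hγg (hbσ.drift y) (hbσ.sigma y u)

lemma PolyDeriv.integrable_eulerStep_sub (hf : PolyDeriv K m f) (hK : 0 ≤ K)
    (hbσ : CoeffBound B S b σ) (hγ : 0 ≤ γ) (y : Vec d) :
    Integrable (fun u => f (eulerStep b σ γ y u) - f y) (stdGaussian (Vec d)) := by
  refine integrable_stdGaussian_of_bound (C := √γ * (K * (1 + √γ * (√γ * B + S)) ^ m *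
    (√γ * B + S) * (1 + ‖y‖) ^ (m + 1))) (n := m + 1)
    (((hf.contDiff.continuous.comp (continuous_eulerStep b σ γ y)).sub
      continuous_const).aestronglyMeasurable) fun u => ?_
  refine (hf.abs_eulerStep_sub_le hK hbσ hγ le_rfl y u).trans_eq ?_
  rw [mul_pow (1 + ‖y‖)]
  ring

/-- The local weak error of the scheme is of order two. -/
lemma PolyDeriv.abs_weak_error_le (hf : PolyDeriv K m f) (hK : 0 ≤ K)
    (hbσ : CoeffBound B S b σ) (hγ : 0 ≤ γ) (hγg : γ ≤ g) (y : Vec d) :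
    |∫ u, (f (eulerStep b σ γ y u) - f y) ∂(stdGaussian (Vec d))
      - γ * generator b (fun y => σ y * (σ y).transpose) f y| ≤
    γ ^ 2 * ((S ^ 4 + B ^ 2 + B * S ^ 2) * (K * (1 + √g * (√g * B + S)) ^ m)
      * gaussMoment d (m + 4) * (1 + ‖y‖) ^ (m + 4)) := by
  set F : Vec d → ℝ := fun u => f (eulerStep b σ γ y u) - f y with hF
  have hFi : Integrable F (stdGaussian (Vec d)) := hf.integrable_eulerStep_sub hK hbσ hγ y
  have hFn : Integrable (fun u => F (-u)) (stdGaussian (Vec d)) := by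
    refine integrable_stdGaussian_of_bound (C := √γ * (K * (1 + √γ * (√γ * B + S)) ^ m *
      (√γ * B + S) * (1 + ‖y‖) ^ (m + 1))) (n := m + 1)
      ((((hf.contDiff.continuous.comp (continuous_eulerStep b σ γ y)).sub
        continuous_const).comp continuous_neg).aestronglyMeasurable) fun u => ?_
    refine (hf.abs_eulerStep_sub_le hK hbσ hγ le_rfl y (-u)).trans_eq ?_
    rw [mul_pow (1 + ‖y‖), norm_neg]
    ring
  obtain ⟨hDi, hD⟩ := integral_iteratedFDeriv_two_stdGaussian f y (σ y)
  have hgen : generator b (fun y => σ y * (σ y).transpose) f y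
      = (1 / 2) * (∫ u, iteratedFDeriv ℝ 2 f y (fun _ => Matrix.toEuclideanLin (σ y) u)
        ∂(stdGaussian (Vec d))) + fderiv ℝ f y (b y) := by
    rw [hD, generator]
    congr 1
    conv_rhs => rw [eq_sum_basisVec (b y)]
    simp [map_sum]
  -- The Gaussian law is symmetric, so `F` may be replaced by its even part; this removes the odd
  -- orders in `√γ` and leaves the integrand of `abs_symm_step_sub_le`.
  have hrepr : ∫ u, F u ∂(stdGaussian (Vec d))
        - γ * generator b (fun y => σ y * (σ y).transpose) f y
      = ∫ u, ((F u + F (-u)) / 2 - γ * fderiv ℝ f y (b y)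
        - γ / 2 * iteratedFDeriv ℝ 2 f y fun _ => Matrix.toEuclideanLin (σ y) u)
          ∂(stdGaussian (Vec d)) := by
    have hs : Integrable (fun u => (F u + F (-u)) / 2) (stdGaussian (Vec d)) :=
      (hFi.add hFn).div_const 2
    have hs' : Integrable (fun u => (F u + F (-u)) / 2 - γ * fderiv ℝ f y (b y))
      (stdGaussian (Vec d)) := hs.sub (integrable_const _)
    rw [integral_sub hs' (hDi.const_mul _), integral_sub hs (integrable_const _), integral_div,
      integral_add hFi hFn, integral_neg_stdGaussian, integral_const_mul (γ / 2), hgen]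
    simp
    ring
  rw [hrepr]
  have hpt : ∀ u, |(F u + F (-u)) / 2 - γ * fderiv ℝ f y (b y)
        - γ / 2 * iteratedFDeriv ℝ 2 f y fun _ => Matrix.toEuclideanLin (σ y) u| ≤
      (γ ^ 2 * ((S ^ 4 + B ^ 2 + B * S ^ 2) * (K * (1 + √g * (√g * B + S)) ^ m)
      * (1 + ‖y‖) ^ (m + 4))) * (1 + ‖u‖) ^ (m + 4) := by
    intro u
    have := hf.abs_symm_step_sub_le hK hbσ.drift_nonneg hbσ.sigma_nonneg hγ hγg (hbσ.drift y)
      (hbσ.sigma y u)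
    rw [mul_pow (1 + ‖y‖)] at this
    convert! this using 1
    · congr 1
      simp only [hF, eulerStep, map_neg, smul_neg, ← sub_eq_add_neg]
      ring
    · ring
  refine (abs_integral_stdGaussian_le hpt).trans_eq ?_
  ring

end WeakError

/-! ### Lyapunov estimates and uniform moments. -/

section Moments

/-- A second order upper bound for powers. -/
lemma add_pow_le_second_order {A D : ℝ} (hA : 0 ≤ A) (hAD : 0 ≤ A + D) (n : ℕ) :
    (A + D) ^ (n + 2) ≤ A ^ (n + 2) + (n + 2) * A ^ (n + 1) * D
      + (n + 2) ^ 2 * (D ^ 2 * (A + |D|) ^ n) := by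
  induction n with
  | zero => norm_num; nlinarith [sq_nonneg D]
  | succ n ih =>
    have h1 := mul_le_mul_of_nonneg_left ih hAD
    have h2 : A + D ≤ A + |D| := by linarith [le_abs_self D]
    have h3 : A ^ (n + 1) ≤ (A + |D|) ^ (n + 1) := by
      gcongr; linarith [abs_nonneg D]
    have h4 : (A + D) * (D ^ 2 * (A + |D|) ^ n) ≤ D ^ 2 * (A + |D|) ^ (n + 1) := by
      calc _ ≤ (A + |D|) * (D ^ 2 * (A + |D|) ^ n) := by gcongr
        _ = _ := by ring
    have h5 : D ^ 2 * A ^ (n + 1) ≤ D ^ 2 * (A + |D|) ^ (n + 1) := by gcongr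
    have h6 : 0 ≤ D ^ 2 * (A + |D|) ^ (n + 1) := by positivity
    calc (A + D) ^ (n + 1 + 2) = (A + D) * (A + D) ^ (n + 2) := by ring
      _ ≤ _ := h1
      _ = A ^ (n + 3) + (n + 3) * A ^ (n + 2) * D + (n + 2) * (D ^ 2 * A ^ (n + 1))
          + (n + 2) ^ 2 * ((A + D) * (D ^ 2 * (A + |D|) ^ n)) := by ring
      _ ≤ A ^ (n + 3) + (n + 3) * A ^ (n + 2) * D + (n + 2) * (D ^ 2 * (A + |D|) ^ (n + 1))
          + (n + 2) ^ 2 * (D ^ 2 * (A + |D|) ^ (n + 1)) := by gcongr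
      -- The coefficients close because `(n + 2) + (n + 2)² ≤ (n + 3)²`.
      _ ≤ _ := by
        push_cast
        have h7 : 0 ≤ ((n : ℝ) + 3) * (D ^ 2 * (A + |D|) ^ (n + 1)) := by positivity
        nlinarith

variable {d : ℕ}

/-- The Lyapunov function `1 + |y|²`. -/
noncomputable def lyap (y : Vec d) : ℝ := 1 + ‖y‖ ^ 2

lemma one_le_lyap (y : Vec d) : 1 ≤ lyap y := by unfold lyap; linarith [sq_nonneg ‖y‖]

lemma lyap_nonneg (y : Vec d) : 0 ≤ lyap y := zero_le_one.trans (one_le_lyap y)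

lemma continuous_lyap : Continuous (lyap : Vec d → ℝ) := by unfold lyap; fun_prop

lemma one_add_norm_sq_le (y : Vec d) : (1 + ‖y‖) ^ 2 ≤ 2 * lyap y := by
  unfold lyap; nlinarith [sq_nonneg (1 - ‖y‖)]

variable {B S g γ c₁ c₂ : ℝ} {b : Vec d → Vec d} {σ : Vec d → Matrix (Fin d) (Fin d) ℝ}

/-- Growth constant of one step of the scheme. -/
noncomputable def stepConst (B S g : ℝ) : ℝ := 8 * B + 2 * S + 8 * g * B ^ 2 + 2 * √g * S ^ 2

lemma stepConst_nonneg (hB : 0 ≤ B) (hS : 0 ≤ S) (hg : 0 ≤ g) : 0 ≤ stepConst B S g := by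
  unfold stepConst; positivity

/-- Keeping `√γ √V` instead of the cruder `√γ V` is essential: its square `γ V` is one power of `V`
below the dissipation, and the other square `γ² V²` carries an extra factor `γ`. Both can therefore
be absorbed in `exists_lyap_contraction`. -/
lemma abs_lyap_eulerStep_sub_le (hbσ : CoeffBound B S b σ) (hγ : 0 ≤ γ) (hγg : γ ≤ g)
    (y u : Vec d) :
    |lyap (eulerStep b σ γ y u) - lyap y| ≤
      stepConst B S g * (γ * lyap y + √γ * √(lyap y)) * (1 + ‖u‖) ^ 2 := by
  have hB := hbσ.drift_nonneg
  have hS := hbσ.sigma_nonneg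
  obtain ⟨r, hr⟩ : ∃ r, r = √(lyap y) := ⟨_, rfl⟩
  have hr2 : r ^ 2 = lyap y := by rw [hr]; exact Real.sq_sqrt (lyap_nonneg y)
  have hr1 : 1 ≤ r := by rw [hr]; exact Real.one_le_sqrt.2 (one_le_lyap y)
  have hyr : ‖y‖ ≤ r := by rw [hr]; exact Real.le_sqrt_of_sq_le (by unfold lyap; linarith)
  obtain ⟨U, hU⟩ : ∃ U, U = 1 + ‖u‖ := ⟨_, rfl⟩
  have hU1 : 1 ≤ U := by rw [hU]; linarith [norm_nonneg u]
  have huU : ‖u‖ ≤ U := by rw [hU]; linarith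
  obtain ⟨q, hq⟩ : ∃ q, q = √γ := ⟨_, rfl⟩
  have hq0 : 0 ≤ q := by rw [hq]; positivity
  have hq2 : γ = q ^ 2 := by rw [hq]; exact (Real.sq_sqrt hγ).symm
  have hqg : q ≤ √g := by rw [hq]; exact Real.sqrt_le_sqrt hγg
  set h : Vec d := γ • b y + √γ • Matrix.toEuclideanLin (σ y) u with hh
  have hn : ‖h‖ ≤ γ * (2 * B * r) + q * (S * U) := by
    refine (norm_add_le _ _).trans ?_
    rw [norm_smul, norm_smul, Real.norm_of_nonneg hγ, Real.norm_of_nonneg (Real.sqrt_nonneg _),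
      ← hq]
    have h1 : ‖b y‖ ≤ 2 * B * r := (hbσ.drift y).trans (by nlinarith)
    have h2 : ‖Matrix.toEuclideanLin (σ y) u‖ ≤ S * U := (hbσ.sigma y u).trans (by gcongr)
    gcongr
  have hdiff : lyap (eulerStep b σ γ y u) - lyap y = 2 * inner ℝ y h + ‖h‖ ^ 2 := by
    rw [eulerStep, add_assoc, ← hh, lyap, lyap, norm_add_sq_real]
    ring
  have hin := abs_real_inner_le_norm y h
  have hb1 : |2 * inner ℝ y h + ‖h‖ ^ 2| ≤ 2 * (r * ‖h‖) + ‖h‖ ^ 2 := by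
    refine (abs_add_le _ _).trans ?_
    rw [abs_mul, abs_two, abs_of_nonneg (sq_nonneg ‖h‖)]
    have : ‖y‖ * ‖h‖ ≤ r * ‖h‖ := by gcongr
    linarith
  rw [hdiff, ← hr, ← hr2, ← hq, ← hU]
  refine hb1.trans ?_
  obtain ⟨N, hN⟩ : ∃ N, N = γ * (2 * B * r) + q * (S * U) := ⟨_, rfl⟩
  rw [← hN] at hn
  have hb2 : 2 * (r * ‖h‖) + ‖h‖ ^ 2 ≤ 2 * (r * N) + N ^ 2 := by gcongr
  refine hb2.trans ?_
  have hNsq : N ^ 2 ≤ 8 * g * B ^ 2 * (γ * r ^ 2) + 2 * √g * S ^ 2 * (q * r * U ^ 2) := by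
    have h1 : N ^ 2 ≤ 2 * (γ * (2 * B * r)) ^ 2 + 2 * (q * (S * U)) ^ 2 := by
      rw [hN]; nlinarith [sq_nonneg (γ * (2 * B * r) - q * (S * U))]
    have h2 : 2 * (γ * (2 * B * r)) ^ 2 ≤ 8 * g * B ^ 2 * (γ * r ^ 2) := by
      calc _ = 8 * γ * B ^ 2 * (γ * r ^ 2) := by ring
        _ ≤ _ := by gcongr
    have h3 : 2 * (q * (S * U)) ^ 2 ≤ 2 * √g * S ^ 2 * (q * r * U ^ 2) := by
      calc _ = 2 * q * S ^ 2 * (q * 1 * U ^ 2) := by ring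
        _ ≤ _ := by gcongr
    linarith
  have hU2 : U ≤ U ^ 2 := by nlinarith
  have hU3 : 1 ≤ U ^ 2 := by nlinarith
  have hrN : 2 * (r * N) ≤ 8 * B * (γ * r ^ 2) + 2 * S * (q * r * U ^ 2) := by
    have h1 : 2 * S * (q * r * U) ≤ 2 * S * (q * r * U ^ 2) := by gcongr
    have h2 : 0 ≤ B * (γ * r ^ 2) := by positivity
    rw [hN]
    linarith
  have hX : 0 ≤ γ * r ^ 2 := by positivity
  have hY : 0 ≤ q * r := by positivity
  have hg : 0 ≤ g := hγ.trans hγg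
  calc 2 * (r * N) + N ^ 2
      ≤ (8 * B + 8 * g * B ^ 2) * (γ * r ^ 2 * 1)
        + (2 * S + 2 * √g * S ^ 2) * (q * r * U ^ 2) := by linarith
    _ ≤ (8 * B + 8 * g * B ^ 2 + (2 * S + 2 * √g * S ^ 2)) * (γ * r ^ 2 * U ^ 2)
        + (2 * S + 2 * √g * S ^ 2 + (8 * B + 8 * g * B ^ 2)) * (q * r * U ^ 2) := by
        have hW : 0 ≤ 8 * B + 8 * g * B ^ 2 := by positivity
        have hW' : 0 ≤ 2 * S + 2 * √g * S ^ 2 := by positivity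
        generalize 8 * B + 8 * g * B ^ 2 = W at *
        generalize 2 * S + 2 * √g * S ^ 2 = W' at *
        gcongr <;> linarith
    _ = _ := by unfold stepConst; ring

/-- Bound of the Lyapunov function after one step. -/
lemma lyap_add_abs_le (hbσ : CoeffBound B S b σ) (hγ : 0 ≤ γ) (hγg : γ ≤ g) (y u : Vec d) :
    lyap y + |lyap (eulerStep b σ γ y u) - lyap y| ≤
      (1 + stepConst B S g * (g + √g)) * lyap y * (1 + ‖u‖) ^ 2 := by
  have hg : 0 ≤ g := hγ.trans hγg
  have h0 := stepConst_nonneg hbσ.drift_nonneg hbσ.sigma_nonneg hg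
  have h1 := abs_lyap_eulerStep_sub_le hbσ hγ hγg y u
  have hv := one_le_lyap y
  have hv0 := lyap_nonneg y
  have h2 : √(lyap y) ≤ lyap y := Real.sqrt_le_self_iff.2 (Or.inr hv)
  have h3 : √γ ≤ √g := Real.sqrt_le_sqrt hγg
  have hU : 1 ≤ (1 + ‖u‖) ^ 2 := one_le_pow₀ (by linarith [norm_nonneg u])
  calc _ ≤ lyap y * (1 + ‖u‖) ^ 2
        + stepConst B S g * (g * lyap y + √g * lyap y) * (1 + ‖u‖) ^ 2 := by
        refine add_le_add (le_mul_of_one_le_right hv0 hU) (h1.trans ?_)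
        gcongr
    _ = _ := by ring

lemma lyap_eulerStep_le (hbσ : CoeffBound B S b σ) (hγ : 0 ≤ γ) (hγg : γ ≤ g) (y u : Vec d) :
    lyap (eulerStep b σ γ y u) ≤
      (1 + stepConst B S g * (g + √g)) * lyap y * (1 + ‖u‖) ^ 2 :=
  le_trans (by linarith [le_abs_self (lyap (eulerStep b σ γ y u) - lyap y)])
    (lyap_add_abs_le hbσ hγ hγg y u)

lemma integrable_lyap_eulerStep_pow (hbσ : CoeffBound B S b σ) (hγ : 0 ≤ γ) (y : Vec d) (n : ℕ) :
    Integrable (fun u => lyap (eulerStep b σ γ y u) ^ n) (stdGaussian (Vec d)) := by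
  refine integrable_stdGaussian_of_bound
    (C := ((1 + stepConst B S γ * (γ + √γ)) * lyap y) ^ n) (n := 2 * n)
    ((continuous_lyap.comp (continuous_eulerStep b σ γ y)).pow n).aestronglyMeasurable fun u => ?_
  have := lyap_nonneg (eulerStep b σ γ y u)
  rw [abs_of_nonneg (by positivity), pow_mul, ← mul_pow]
  gcongr
  exact lyap_eulerStep_le hbσ hγ le_rfl y u

/-- Crude bound of the moments after one step. -/
lemma integral_lyap_eulerStep_pow_le (hbσ : CoeffBound B S b σ) (hγ : 0 ≤ γ) (hγg : γ ≤ g)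
    (y : Vec d) (n : ℕ) :
    ∫ u, lyap (eulerStep b σ γ y u) ^ n ∂(stdGaussian (Vec d)) ≤
      (1 + stepConst B S g * (g + √g)) ^ n * gaussMoment d (2 * n) * lyap y ^ n := by
  refine (le_abs_self _).trans ((abs_integral_stdGaussian_le
    (C := ((1 + stepConst B S g * (g + √g)) * lyap y) ^ n) (n := 2 * n) fun u => ?_).trans_eq ?_)
  · have := lyap_nonneg (eulerStep b σ γ y u)
    rw [abs_of_nonneg (by positivity), pow_mul, ← mul_pow]
    gcongr
    exact lyap_eulerStep_le hbσ hγ hγg y u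
  · rw [mul_pow]
    ring

lemma integral_odd_stdGaussian {F : Vec d → ℝ} (hF : ∀ u, F (-u) = -F u) :
    ∫ u, F u ∂(stdGaussian (Vec d)) = 0 := by
  have h := integral_neg_stdGaussian F
  simp only [hF, integral_neg] at h
  linarith

/-- The mean increment of the Lyapunov function along one step. -/
lemma integral_lyap_eulerStep_sub_le (hbσ : CoeffBound B S b σ)
    (hdiss : ∀ y, inner ℝ (b y) y ≤ -c₁ * ‖y‖ ^ 2 + c₂) (hγ : 0 ≤ γ)
    (hγB : 2 * γ * B ^ 2 ≤ c₁) (y : Vec d) :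
    ∫ u, (lyap (eulerStep b σ γ y u) - lyap y) ∂(stdGaussian (Vec d)) ≤
      γ * (-c₁ * lyap y + (2 * c₁ + 2 * |c₂| + S ^ 2 * gaussMoment d 2)) := by
  set z : Vec d := y + γ • b y with hz
  have hσc := LinearMap.continuous_of_finiteDimensional (Matrix.toEuclideanLin (σ y))
  have hexp : ∀ u, lyap (eulerStep b σ γ y u) - lyap y = (2 * γ * inner ℝ (b y) y
      + γ ^ 2 * ‖b y‖ ^ 2) + 2 * √γ * inner ℝ z (Matrix.toEuclideanLin (σ y) u)
      + γ * ‖Matrix.toEuclideanLin (σ y) u‖ ^ 2 := by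
    intro u
    rw [eulerStep, ← hz, lyap, lyap, norm_add_sq_real, norm_smul, inner_smul_right,
      Real.norm_of_nonneg (Real.sqrt_nonneg _), mul_pow, Real.sq_sqrt hγ]
    have : ‖z‖ ^ 2 = ‖y‖ ^ 2 + 2 * γ * inner ℝ (b y) y + γ ^ 2 * ‖b y‖ ^ 2 := by
      rw [hz, norm_add_sq_real, norm_smul, inner_smul_right, Real.norm_of_nonneg hγ,
        real_inner_comm]
      ring
    rw [this]
    ring
  have hsq : ∀ u, |‖Matrix.toEuclideanLin (σ y) u‖ ^ 2| ≤ S ^ 2 * (1 + ‖u‖) ^ 2 := by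
    intro u
    have h0 := hbσ.sigma_nonneg
    rw [abs_of_nonneg (by positivity), ← mul_pow]
    gcongr
    exact (hbσ.sigma y u).trans (by gcongr; linarith)
  have hi1 : Integrable (fun u => 2 * √γ * inner ℝ z (Matrix.toEuclideanLin (σ y) u))
      (stdGaussian (Vec d)) := by
    refine (integrable_stdGaussian_of_bound (C := ‖z‖ * S) (n := 1)
      (Continuous.aestronglyMeasurable (by fun_prop)) fun u => ?_).const_mul _
    have h0 := hbσ.sigma_nonneg
    calc _ ≤ ‖z‖ * ‖Matrix.toEuclideanLin (σ y) u‖ := abs_real_inner_le_norm _ _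
      _ ≤ ‖z‖ * (S * (1 + ‖u‖)) := by
          gcongr
          exact (hbσ.sigma y u).trans (by gcongr; linarith)
      _ = _ := by ring
  have hi2 : Integrable (fun u => γ * ‖Matrix.toEuclideanLin (σ y) u‖ ^ 2)
      (stdGaussian (Vec d)) :=
    (integrable_stdGaussian_of_bound (Continuous.aestronglyMeasurable (by fun_prop))
      hsq).const_mul _
  simp only [hexp]
  have hi3 : Integrable (fun u => (2 * γ * inner ℝ (b y) y + γ ^ 2 * ‖b y‖ ^ 2)
      + 2 * √γ * inner ℝ z (Matrix.toEuclideanLin (σ y) u)) (stdGaussian (Vec d)) :=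
    (integrable_const _).add hi1
  rw [integral_add hi3 hi2, integral_add (integrable_const _) hi1,
    integral_odd_stdGaussian (F := fun u => 2 * √γ * inner ℝ z (Matrix.toEuclideanLin (σ y) u))
      (fun u => by simp),
    integral_const_mul γ]
  have h4 := (le_abs_self _).trans (abs_integral_stdGaussian_le hsq)
  -- The smallness of `γ` makes the squared drift consume only half of the dissipation `2 c₁ γ
  -- ‖y‖²`.
  have h5 : γ ^ 2 * ‖b y‖ ^ 2 ≤ γ * (c₁ * lyap y) := by
    have hb : ‖b y‖ ^ 2 ≤ B ^ 2 * (2 * lyap y) := by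
      calc _ ≤ (B * (1 + ‖y‖)) ^ 2 := by gcongr; exact hbσ.drift y
        _ = B ^ 2 * (1 + ‖y‖) ^ 2 := by ring
        _ ≤ _ := by gcongr; exact one_add_norm_sq_le y
    have hl := lyap_nonneg y
    calc _ ≤ γ ^ 2 * (B ^ 2 * (2 * lyap y)) := by gcongr
      _ = γ * (2 * γ * B ^ 2 * lyap y) := by ring
      _ ≤ _ := by gcongr
  have h6 := mul_le_mul_of_nonneg_left (hdiss y) hγ
  have h7 : γ * c₂ ≤ γ * |c₂| := by gcongr; exact le_abs_self _
  have h8 := mul_le_mul_of_nonneg_left h4 hγ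
  have h9 : ‖y‖ ^ 2 = lyap y - 1 := by unfold lyap; ring
  rw [h9] at h6
  simp only [integral_const, smul_eq_mul, probReal_univ, one_mul, add_zero]
  linarith

/-- For small steps the scheme contracts the moments, up to a constant. -/
lemma exists_lyap_contraction (d : ℕ) {B S g c₁ : ℝ} (c₂ : ℝ) (hB : 0 ≤ B) (hS : 0 ≤ S)
    (hg : 0 ≤ g) (hc₁ : 0 < c₁) (n : ℕ) :
    ∃ δ > 0, ∃ C, 0 ≤ C ∧ ∀ (b : Vec d → Vec d) (σ : Vec d → Matrix (Fin d) (Fin d) ℝ),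
      CoeffBound B S b σ → (∀ y, inner ℝ (b y) y ≤ -c₁ * ‖y‖ ^ 2 + c₂) →
      ∀ γ, 0 ≤ γ → γ ≤ g → γ ≤ δ → ∀ y,
        ∫ u, lyap (eulerStep b σ γ y u) ^ (n + 2) ∂(stdGaussian (Vec d)) ≤
          (1 - c₁ / 2 * γ) * lyap y ^ (n + 2) + C * γ := by
  set C₁ := 2 * c₁ + 2 * |c₂| + S ^ 2 * gaussMoment d 2 with hC₁
  set C₂ := stepConst B S g with hC₂
  set C₃ := 1 + C₂ * (g + √g) with hC₃
  set C₄ := ((n : ℝ) + 2) ^ 2 * (2 * C₂ ^ 2 * C₃ ^ n) * gaussMoment d (2 * n + 4) with hC₄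
  set C₅ := ((n : ℝ) + 2) * C₁ + C₄ with hC₅
  have hC₂0 : 0 ≤ C₂ := stepConst_nonneg hB hS hg
  have hC₃0 : 0 ≤ C₃ := by positivity
  have hm2 := gaussMoment_nonneg d 2
  have hm4 := gaussMoment_nonneg d (2 * n + 4)
  have hC₁0 : 0 ≤ C₁ := by positivity
  have hC₄0 : 0 ≤ C₄ := by positivity
  have hC₅0 : 0 ≤ C₅ := by positivity
  -- The first threshold is the one needed for the mean increment, the second gives `γ * C₄ ≤ c₁`.
  -- The additive constant is the value of `C₅ V ^ (n + 1)` at the crossover `V = 2 C₅ / c₁` of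
  -- `h3`.
  refine ⟨min (c₁ / (2 * B ^ 2 + 1)) (c₁ / (C₄ + 1)), by positivity,
    C₅ * (2 * C₅ / c₁) ^ (n + 1), by positivity, fun b σ hbσ hdiss γ hγ hγg hγδ y => ?_⟩
  have hγB : 2 * γ * B ^ 2 ≤ c₁ := by
    have := (le_div_iff₀ (by positivity)).1 (hγδ.trans (min_le_left _ _))
    nlinarith
  have hγC : γ * C₄ ≤ c₁ := by
    have := (le_div_iff₀ (by positivity)).1 (hγδ.trans (min_le_right _ _))
    nlinarith
  set V := lyap y with hV
  have hV0 : 0 ≤ V := lyap_nonneg y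
  set D : Vec d → ℝ := fun u => lyap (eulerStep b σ γ y u) - V with hD
  have hDi : Integrable D (stdGaussian (Vec d)) := by
    have := integrable_lyap_eulerStep_pow hbσ hγ y 1
    simp only [pow_one] at this
    exact this.sub (integrable_const _)
  have hpt : ∀ u, lyap (eulerStep b σ γ y u) ^ (n + 2) ≤ V ^ (n + 2)
      + (n + 2) * V ^ (n + 1) * D u + (n + 2) ^ 2 * (2 * C₂ ^ 2 * C₃ ^ n)
        * (γ ^ 2 * V ^ (n + 2) + γ * V ^ (n + 1)) * (1 + ‖u‖) ^ (2 * n + 4) := by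
    intro u
    have e1 : lyap (eulerStep b σ γ y u) = V + D u := by simp [hD]
    have hnn : 0 ≤ V + D u := e1 ▸ lyap_nonneg _
    rw [e1]
    refine (add_pow_le_second_order hV0 hnn n).trans ?_
    have k1 : |D u| ≤ C₂ * (γ * V + √γ * √V) * (1 + ‖u‖) ^ 2 :=
      abs_lyap_eulerStep_sub_le hbσ hγ hγg y u
    have k2 : V + |D u| ≤ C₃ * V * (1 + ‖u‖) ^ 2 := lyap_add_abs_le hbσ hγ hγg y u
    have k3 : (D u) ^ 2 ≤ 2 * C₂ ^ 2 * (γ ^ 2 * V ^ 2 + γ * V) * (1 + ‖u‖) ^ 4 := by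
      rw [← sq_abs]
      calc |D u| ^ 2 ≤ (C₂ * (γ * V + √γ * √V) * (1 + ‖u‖) ^ 2) ^ 2 := by gcongr
        _ = C₂ ^ 2 * (γ * V + √γ * √V) ^ 2 * (1 + ‖u‖) ^ 4 := by ring
        _ ≤ C₂ ^ 2 * (2 * (γ ^ 2 * V ^ 2 + γ * V)) * (1 + ‖u‖) ^ 4 := by
            gcongr
            have s1 : (√γ * √V) ^ 2 = γ * V := by
              rw [mul_pow, Real.sq_sqrt hγ, Real.sq_sqrt hV0]
            nlinarith [sq_nonneg (γ * V - √γ * √V)]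
        _ = _ := by ring
    have k4 : (D u) ^ 2 * (V + |D u|) ^ n ≤
        (2 * C₂ ^ 2 * (γ ^ 2 * V ^ 2 + γ * V) * (1 + ‖u‖) ^ 4)
          * (C₃ * V * (1 + ‖u‖) ^ 2) ^ n := by gcongr
    have k5 := mul_le_mul_of_nonneg_left k4 (show (0 : ℝ) ≤ ((n : ℝ) + 2) ^ 2 by positivity)
    refine (add_le_add_right k5 _).trans (le_of_eq ?_)
    rw [mul_pow, mul_pow, ← pow_mul]
    ring
  have hint : ∫ u, lyap (eulerStep b σ γ y u) ^ (n + 2) ∂(stdGaussian (Vec d)) ≤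
      V ^ (n + 2) + (n + 2) * V ^ (n + 1) * (∫ u, D u ∂(stdGaussian (Vec d)))
        + C₄ * (γ ^ 2 * V ^ (n + 2) + γ * V ^ (n + 1)) := by
    have i1 : Integrable (fun u => V ^ (n + 2) + (n + 2) * V ^ (n + 1) * D u)
        (stdGaussian (Vec d)) := (integrable_const _).add (hDi.const_mul _)
    have i2 := (integrable_weight_stdGaussian (d := d) (2 * n + 4)).const_mul
      (((n : ℝ) + 2) ^ 2 * (2 * C₂ ^ 2 * C₃ ^ n) * (γ ^ 2 * V ^ (n + 2) + γ * V ^ (n + 1)))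
    refine (integral_mono (integrable_lyap_eulerStep_pow hbσ hγ y (n + 2)) (i1.add i2)
      hpt).trans (le_of_eq ?_)
    rw [integral_add' i1 i2, integral_add (integrable_const _) (hDi.const_mul _),
      integral_const_mul, integral_const_mul, ← gaussMoment]
    simp only [integral_const, smul_eq_mul, probReal_univ, one_mul]
    rw [hC₄]
    ring
  have hDle : ∫ u, D u ∂(stdGaussian (Vec d)) ≤ γ * (-c₁ * V + C₁) :=
    integral_lyap_eulerStep_sub_le hbσ hdiss hγ hγB y
  have h1 : (n + 2) * V ^ (n + 1) * (∫ u, D u ∂(stdGaussian (Vec d))) ≤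
      (n + 2) * V ^ (n + 1) * (γ * (-c₁ * V + C₁)) := by gcongr
  have h2 : γ * C₄ * (γ * V ^ (n + 2)) ≤ c₁ * (γ * V ^ (n + 2)) := by gcongr
  -- Of the `n + 2` copies of `c₁ γ V ^ (n + 2)` supplied by the drift, one absorbs the `γ²` term,
  -- half of another absorbs this lower power of `V`, and the remaining half is the contraction.
  have h3 : C₅ * V ^ (n + 1) ≤ c₁ / 2 * V ^ (n + 2) + C₅ * (2 * C₅ / c₁) ^ (n + 1) := by
    rcases le_total V (2 * C₅ / c₁) with hle | hle
    · have : C₅ * V ^ (n + 1) ≤ C₅ * (2 * C₅ / c₁) ^ (n + 1) := by gcongr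
      have : 0 ≤ c₁ / 2 * V ^ (n + 2) := by positivity
      linarith
    · have h4 : C₅ ≤ c₁ / 2 * V := by
        rw [div_le_iff₀ hc₁] at hle
        linarith
      have : C₅ * V ^ (n + 1) ≤ c₁ / 2 * V * V ^ (n + 1) := by gcongr
      have : 0 ≤ C₅ * (2 * C₅ / c₁) ^ (n + 1) := by positivity
      have e : c₁ / 2 * V ^ (n + 2) = c₁ / 2 * V * V ^ (n + 1) := by ring
      linarith
  have h3' := mul_le_mul_of_nonneg_left h3 hγ
  have h5 : 0 ≤ (n : ℝ) * (c₁ * (γ * V ^ (n + 2))) := by positivity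
  calc _ ≤ _ := hint
    _ ≤ V ^ (n + 2) + (n + 2) * V ^ (n + 1) * (γ * (-c₁ * V + C₁))
        + C₄ * (γ ^ 2 * V ^ (n + 2) + γ * V ^ (n + 1)) := by gcongr
    _ = V ^ (n + 2) - n * (c₁ * (γ * V ^ (n + 2))) - 2 * (c₁ * (γ * V ^ (n + 2)))
        + γ * C₄ * (γ * V ^ (n + 2)) + γ * (C₅ * V ^ (n + 1)) := by rw [hC₅]; ring
    _ ≤ V ^ (n + 2) - c₁ * (γ * V ^ (n + 2))
        + γ * (c₁ / 2 * V ^ (n + 2) + C₅ * (2 * C₅ / c₁) ^ (n + 1)) := by linarith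
    _ = _ := by ring

/-- A sequence with bounded growth that is eventually contracted stays bounded, with a bound that
depends only on the constants. -/
lemma exists_bound_of_eventual_contraction {γ : ℕ → ℝ} (hγ : ∀ k, 0 < γ k)
    (hγ0 : Tendsto γ atTop (𝓝 0)) {δ c A C e₀ : ℝ} (hδ : 0 < δ) (hc : 0 < c) (hC : 0 ≤ C)
    (he₀ : 0 ≤ e₀) :
    ∃ M, 0 ≤ M ∧ ∀ e : ℕ → ℝ, e 0 = e₀ → (∀ k, 0 ≤ e k) → (∀ k, e (k + 1) ≤ A * e k) →
      (∀ k, γ (k + 1) ≤ δ → e (k + 1) ≤ (1 - c * γ (k + 1)) * e k + C * γ (k + 1)) →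
      ∀ k, e k ≤ M := by
  -- `k₀` depends only on `γ`, `δ` and `c`, hence the uniform bound. Up to `k₀` the sequence grows
  -- at most geometrically; afterwards the contraction, whose fixed point is `C / c`, preserves the
  -- bound. The threshold `1 / c` keeps `1 - c γ` nonnegative.
  obtain ⟨k₀, hk₀⟩ := eventually_atTop.1
    (hγ0.eventually (ge_mem_nhds (show (0 : ℝ) < min δ (1 / c) by positivity)))
  refine ⟨max A 1 ^ k₀ * e₀ + C / c, by positivity, fun e h0 hnn hA hcon => ?_⟩
  have hearly : ∀ k, e k ≤ max A 1 ^ k * e₀ := by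
    intro k
    induction k with
    | zero => simp [h0]
    | succ k ih =>
      calc e (k + 1) ≤ A * e k := hA k
        _ ≤ max A 1 * (max A 1 ^ k * e₀) := by
            gcongr
            · exact hnn k
            · exact le_max_left _ _
        _ = _ := by ring
  have hlate : ∀ j, e (k₀ + j) ≤ max A 1 ^ k₀ * e₀ + C / c := by
    intro j
    induction j with
    | zero =>
      have : 0 ≤ C / c := by positivity
      exact (hearly k₀).trans (by linarith)
    | succ j ih =>
      have hs := hk₀ (k₀ + j + 1) (by omega)
      have h1 := hcon (k₀ + j) (hs.trans (min_le_left _ _))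
      have h2 : 0 ≤ 1 - c * γ (k₀ + j + 1) := by
        have := (le_div_iff₀ hc).1 (hs.trans (min_le_right _ _))
        linarith
      have h3 : 0 ≤ max A 1 ^ k₀ * e₀ * (c * γ (k₀ + j + 1)) := by
        have := hγ (k₀ + j + 1)
        positivity
      have h4 : C / c * (c * γ (k₀ + j + 1)) = C * γ (k₀ + j + 1) := by field_simp
      calc e (k₀ + (j + 1)) ≤ _ := h1
        _ ≤ (1 - c * γ (k₀ + j + 1)) * (max A 1 ^ k₀ * e₀ + C / c) + C * γ (k₀ + j + 1) := by
            gcongr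
        _ ≤ _ := by linarith
  intro k
  rcases le_total k k₀ with hk | hk
  · have : 0 ≤ C / c := by positivity
    have h1 : max A 1 ^ k * e₀ ≤ max A 1 ^ k₀ * e₀ := by
      gcongr
      exact le_max_right _ _
    linarith [hearly k]
  · obtain ⟨j, rfl⟩ := Nat.exists_eq_add_of_le hk
    exact hlate j

end Moments

/-! ### The scheme as a Markov chain driven by independent Gaussian noise. -/

section Chain

variable {d : ℕ} {Ω : Type*} {mΩ : MeasurableSpace Ω} {P : Measure Ω} {U : ℕ → Ω → Vec d}

/-- A sequence of independent standard Gaussian vectors. -/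
structure IsGaussianNoise (U : ℕ → Ω → Vec d) (P : Measure Ω) : Prop where
  measurable : ∀ k, Measurable (U k)
  law : ∀ k, HasLaw (U k) (stdGaussian (Vec d)) P
  indep : iIndepFun U P

/-- The σ-algebra generated by `U 0, …, U (k - 1)`. -/
abbrev past (U : ℕ → Ω → Vec d) (k : ℕ) : MeasurableSpace Ω :=
  ⨆ j ∈ Set.Iio k, MeasurableSpace.comap (U j) inferInstance

lemma past_mono (U : ℕ → Ω → Vec d) {j k : ℕ} (h : j ≤ k) : past U j ≤ past U k :=
  biSup_mono fun _ hi => lt_of_lt_of_le hi h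

lemma measurable_past_succ (U : ℕ → Ω → Vec d) (k : ℕ) : Measurable[past U (k + 1)] (U k) :=
  Measurable.of_comap_le (le_biSup (fun j => MeasurableSpace.comap (U j) inferInstance)
    (Set.mem_Iio.2 k.lt_succ_self))

lemma IsGaussianNoise.past_le (hU : IsGaussianNoise U P) (k : ℕ) : past U k ≤ mΩ :=
  iSup₂_le fun j _ => (hU.measurable j).comap_le

/-- The past at time `k` involves only the indices below `k`, which are disjoint from `{k}`. The
state at time `k` is of this kind, so it is independent of the noise of the next step. -/
lemma IsGaussianNoise.indepFun_of_past (hU : IsGaussianNoise U P) {k : ℕ} {𝓧 : Type*}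
    [MeasurableSpace 𝓧] {X : Ω → 𝓧} (hX : Measurable[past U k] X) : IndepFun X (U k) P := by
  have h : Indep (past U k) (⨆ j ∈ ({k} : Set ℕ), MeasurableSpace.comap (U j) inferInstance) P :=
    indep_iSup_of_disjoint (fun j => (hU.measurable j).comap_le) hU.indep (by simp)
  rw [iSup_singleton] at h
  exact indep_of_indep_of_le_left h hX.comap_le

variable {𝓧 : Type*} [MeasurableSpace 𝓧] {X : Ω → 𝓧} {V : Ω → Vec d}

/-- Integration of a function of two independent variables. -/
lemma integral_indep_stdGaussian [IsProbabilityMeasure P] (hX : Measurable X)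
    (hV : HasLaw V (stdGaussian (Vec d)) P) (h : IndepFun X V P) {g : 𝓧 × Vec d → ℝ}
    (hg : Measurable g) (hi : Integrable (fun ω => g (X ω, V ω)) P) :
    ∫ ω, g (X ω, V ω) ∂P = ∫ ω, ∫ u, g (X ω, u) ∂(stdGaussian (Vec d)) ∂P := by
  have hlaw : P.map (fun ω => (X ω, V ω)) = (P.map X).prod (stdGaussian (Vec d)) := by
    rw [h.map_prod_eq_prod_map_map hX.aemeasurable hV.aemeasurable, hV.map_eq]
  have : IsProbabilityMeasure (P.map X) := Measure.isProbabilityMeasure_map hX.aemeasurable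
  have hXV : AEMeasurable (fun ω => (X ω, V ω)) P := hX.aemeasurable.prodMk hV.aemeasurable
  have hi' : Integrable g ((P.map X).prod (stdGaussian (Vec d))) := by
    rw [← hlaw]
    exact (integrable_map_measure hg.aestronglyMeasurable hXV).2 hi
  rw [← integral_map (f := g) hXV hg.aestronglyMeasurable, hlaw, integral_prod _ hi',
    integral_map hX.aemeasurable]
  exact hg.stronglyMeasurable.integral_prod_right'.aestronglyMeasurable

/-- Integrability and size of a function of two independent variables, one being Gaussian. -/
lemma integrable_indep_of_bound (hX : Measurable X)
    (hV : HasLaw V (stdGaussian (Vec d)) P) (h : IndepFun X V P) {g : 𝓧 × Vec d → ℝ}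
    (hg : Measurable g) {w : 𝓧 → ℝ} (hw : Measurable w) (hwi : Integrable (fun ω => w (X ω)) P)
    {n : ℕ} (hgw : ∀ x u, |g (x, u)| ≤ w x * (1 + ‖u‖) ^ n) :
    Integrable (fun ω => g (X ω, V ω)) P ∧
      |∫ ω, g (X ω, V ω) ∂P| ≤ (∫ ω, w (X ω) ∂P) * gaussMoment d n := by
  have hm : Measurable fun u : Vec d => (1 + ‖u‖) ^ n := by fun_prop
  have hVi : Integrable (fun ω => (1 + ‖V ω‖) ^ n) P := by
    have := integrable_weight_stdGaussian (d := d) n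
    rw [← hV.map_eq] at this
    exact this.comp_aemeasurable hV.aemeasurable
  have hind : IndepFun (fun ω => w (X ω)) (fun ω => (1 + ‖V ω‖) ^ n) P := h.comp hw hm
  have hmul : Integrable (fun ω => w (X ω) * (1 + ‖V ω‖) ^ n) P := hind.integrable_mul hwi hVi
  have hmeas : AEStronglyMeasurable (fun ω => g (X ω, V ω)) P :=
    (hg.comp_aemeasurable (hX.aemeasurable.prodMk hV.aemeasurable)).aestronglyMeasurable
  refine ⟨hmul.mono' hmeas (ae_of_all _ fun ω => hgw _ _), ?_⟩
  rw [← Real.norm_eq_abs]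
  refine (norm_integral_le_of_norm_le hmul (ae_of_all _ fun ω => hgw _ _)).trans_eq ?_
  have e1 : ∫ ω, (1 + ‖V ω‖) ^ n ∂P = gaussMoment d n :=
    hV.integral_comp hm.aestronglyMeasurable
  rw [← e1]
  exact hind.integral_fun_mul_eq_mul_integral hwi.aestronglyMeasurable hVi.aestronglyMeasurable

variable {B S g c₁ c₂ : ℝ} {b : Vec d → Vec d} {σ : Vec d → Matrix (Fin d) (Fin d) ℝ}
  {γ : ℕ → ℝ}

/-- The Euler scheme driven by the noise `U`. -/
noncomputable def chain (b : Vec d → Vec d) (σ : Vec d → Matrix (Fin d) (Fin d) ℝ) (γ : ℕ → ℝ)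
    (U : ℕ → Ω → Vec d) (y₀ : Vec d) : ℕ → Ω → Vec d
  | 0, _ => y₀
  | k + 1, ω => eulerStep b σ (γ (k + 1)) (chain b σ γ U y₀ k ω) (U k ω)

lemma measurable_eulerStep (hb : Continuous b) (hσ : ∀ i j, Measurable fun y => σ y i j)
    (γ : ℝ) : Measurable fun p : Vec d × Vec d => eulerStep b σ γ p.1 p.2 := by
  have hb' := hb.measurable
  have h : Measurable fun p : Vec d × Vec d => Matrix.toEuclideanLin (σ p.1) p.2 := by
    refine (WithLp.measurable_toLp 2 (Fin d → ℝ)).comp (measurable_pi_lambda _ fun i => ?_)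
    have : ∀ p : Vec d × Vec d, (σ p.1).mulVec p.2.ofLp i = ∑ j, σ p.1 i j * p.2 j := fun p => rfl
    change Measurable fun p : Vec d × Vec d => (σ p.1).mulVec p.2.ofLp i
    simp only [this]
    have hc : ∀ j, Measurable fun u : Vec d => u j := fun j =>
      (EuclideanSpace.proj (𝕜 := ℝ) j).continuous.measurable
    exact Finset.measurable_sum _ fun j _ =>
      ((hσ i j).comp measurable_fst).mul ((hc j).comp measurable_snd)
  unfold eulerStep
  fun_prop

lemma measurable_past_chain (hb : Continuous b) (hσ : ∀ i j, Measurable fun y => σ y i j)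
    (y₀ : Vec d) (k : ℕ) : Measurable[past U k] (chain b σ γ U y₀ k) := by
  induction k with
  | zero => exact measurable_const
  | succ k ih =>
    exact (measurable_eulerStep hb hσ (γ (k + 1))).comp
      ((ih.mono (past_mono U k.le_succ) le_rfl).prodMk (measurable_past_succ U k))

lemma IsGaussianNoise.measurable_chain (hU : IsGaussianNoise U P) (hb : Continuous b)
    (hσ : ∀ i j, Measurable fun y => σ y i j) (y₀ : Vec d) (k : ℕ) :
    Measurable (chain b σ γ U y₀ k) :=
  (measurable_past_chain hb hσ y₀ k).mono (hU.past_le k) le_rfl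

lemma IsGaussianNoise.integrable_lyap_chain_pow [IsProbabilityMeasure P]
    (hU : IsGaussianNoise U P)
    (hb : Continuous b) (hσ : ∀ i j, Measurable fun y => σ y i j) (hbσ : CoeffBound B S b σ)
    (hγ : ∀ k, 0 ≤ γ k) (y₀ : Vec d) (n k : ℕ) :
    Integrable (fun ω => lyap (chain b σ γ U y₀ k ω) ^ n) P := by
  induction k with
  | zero => exact (integrable_const (lyap y₀ ^ n) : Integrable (fun _ : Ω => lyap y₀ ^ n) P)
  | succ k ih =>
    have hm : Measurable fun p : Vec d × Vec d => lyap (eulerStep b σ (γ (k + 1)) p.1 p.2) ^ n :=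
      (continuous_lyap.measurable.comp (measurable_eulerStep hb hσ _)).pow_const n
    refine (integrable_indep_of_bound (hU.measurable_chain hb hσ y₀ k) (hU.law k)
      (hU.indepFun_of_past (measurable_past_chain hb hσ y₀ k)) hm
      (w := fun y => (1 + stepConst B S (γ (k + 1)) * (γ (k + 1) + √(γ (k + 1)))) ^ n * lyap y ^ n)
      (continuous_const.mul (continuous_lyap.pow n)).measurable (ih.const_mul _) (n := 2 * n)
      fun y u => ?_).1
    have := lyap_nonneg (eulerStep b σ (γ (k + 1)) y u)
    rw [abs_of_nonneg (by positivity), pow_mul, ← mul_pow, ← mul_pow]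
    gcongr
    exact lyap_eulerStep_le hbσ (hγ _) le_rfl y u

/-- The moments of the scheme are bounded, uniformly over coefficients with the same constants. -/
lemma exists_moment_bound (P : Measure Ω) [IsProbabilityMeasure P] (c₂ : ℝ) (hB : 0 ≤ B)
    (hS : 0 ≤ S) (hc₁ : 0 < c₁) (hγ : ∀ k, 0 < γ k) (hγa : Antitone γ)
    (hγ0 : Tendsto γ atTop (𝓝 0)) (y₀ : Vec d) (n : ℕ) :
    ∃ M, 0 ≤ M ∧ ∀ (b : Vec d → Vec d) (σ : Vec d → Matrix (Fin d) (Fin d) ℝ)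
      (U : ℕ → Ω → Vec d), IsGaussianNoise U P → Continuous b →
      (∀ i j, Measurable fun y => σ y i j) → CoeffBound B S b σ →
      (∀ y, inner ℝ (b y) y ≤ -c₁ * ‖y‖ ^ 2 + c₂) →
      ∀ k, Integrable (fun ω => (1 + ‖chain b σ γ U y₀ k ω‖) ^ n) P ∧
        ∫ ω, (1 + ‖chain b σ γ U y₀ k ω‖) ^ n ∂P ≤ M := by
  have hg : 0 ≤ γ 0 := (hγ 0).le
  obtain ⟨δ, hδ, C, hC, hcon⟩ := exists_lyap_contraction d c₂ hB hS hg hc₁ n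
  obtain ⟨M, hM, hbd⟩ := exists_bound_of_eventual_contraction hγ hγ0
    -- `A` is the crude one-step growth factor, valid for steps of any size up to `γ 0`; it serves
    -- the initial steps, where contraction is not available.
    (A := (1 + stepConst B S (γ 0) * (γ 0 + √(γ 0))) ^ (n + 2) * gaussMoment d (2 * (n + 2)))
    (C := C) (c := c₁ / 2) (e₀ := lyap y₀ ^ (n + 2)) hδ (by positivity) hC
    (pow_nonneg (lyap_nonneg _) _)
  refine ⟨2 ^ n * M, by positivity, fun b σ U hU hb hσ hbσ hdiss k => ?_⟩
  have hYm := hU.measurable_chain (γ := γ) hb hσ y₀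
  have hint := hU.integrable_lyap_chain_pow hb hσ hbσ (fun k => (hγ k).le) y₀ (n + 2)
  have hrec : ∀ k, ∫ ω, lyap (chain b σ γ U y₀ (k + 1) ω) ^ (n + 2) ∂P
      = ∫ ω, ∫ u, lyap (eulerStep b σ (γ (k + 1)) (chain b σ γ U y₀ k ω) u) ^ (n + 2)
        ∂(stdGaussian (Vec d)) ∂P := fun k =>
    integral_indep_stdGaussian (hYm k) (hU.law k)
      (hU.indepFun_of_past (measurable_past_chain hb hσ y₀ k))
      (g := fun p => lyap (eulerStep b σ (γ (k + 1)) p.1 p.2) ^ (n + 2))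
      ((continuous_lyap.measurable.comp (measurable_eulerStep hb hσ _)).pow_const _) (hint (k + 1))
  have hmoment : ∀ k, ∫ ω, lyap (chain b σ γ U y₀ k ω) ^ (n + 2) ∂P ≤ M := by
    refine hbd _ ?_ ?_ ?_ ?_
    · simp [chain]
    · exact fun k => integral_nonneg fun ω => pow_nonneg (lyap_nonneg _) _
    · intro k
      rw [hrec k, ← integral_const_mul]
      refine integral_mono_of_nonneg (ae_of_all _ fun ω => integral_nonneg fun u =>
        pow_nonneg (lyap_nonneg _) _) ((hint k).const_mul _) (ae_of_all _ fun ω => ?_)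
      exact integral_lyap_eulerStep_pow_le hbσ (hγ _).le (hγa (Nat.zero_le _)) _ _
    · intro k hk
      rw [hrec k, ← integral_const_mul]
      have hi : Integrable (fun ω => (1 - c₁ / 2 * γ (k + 1)) *
          lyap (chain b σ γ U y₀ k ω) ^ (n + 2)) P := (hint k).const_mul _
      have : (∫ ω, (1 - c₁ / 2 * γ (k + 1)) * lyap (chain b σ γ U y₀ k ω) ^ (n + 2) ∂P)
          + C * γ (k + 1) = ∫ ω, ((1 - c₁ / 2 * γ (k + 1)) *
            lyap (chain b σ γ U y₀ k ω) ^ (n + 2) + C * γ (k + 1)) ∂P := by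
        rw [integral_add hi (integrable_const _)]
        simp
      rw [this]
      refine integral_mono_of_nonneg (ae_of_all _ fun ω => integral_nonneg fun u =>
        pow_nonneg (lyap_nonneg _) _) (hi.add (integrable_const _)) (ae_of_all _ fun ω => ?_)
      exact hcon b σ hbσ hdiss _ (hγ _).le (hγa (Nat.zero_le _)) hk _
  have hpt : ∀ ω, (1 + ‖chain b σ γ U y₀ k ω‖) ^ n
      ≤ 2 ^ n * lyap (chain b σ γ U y₀ k ω) ^ (n + 2) := by
    intro ω
    set y := chain b σ γ U y₀ k ω
    have h1 : 1 + ‖y‖ ≤ (1 + ‖y‖) ^ 2 := by nlinarith [norm_nonneg y]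
    calc (1 + ‖y‖) ^ n ≤ (2 * lyap y) ^ n := by
          gcongr
          exact h1.trans (one_add_norm_sq_le y)
      _ = 2 ^ n * lyap y ^ n := by ring
      _ ≤ _ := by
          gcongr
          · exact one_le_lyap y
          · omega
  have hm : Measurable fun ω => (1 + ‖chain b σ γ U y₀ k ω‖) ^ n :=
    ((hYm k).norm.const_add 1).pow_const n
  have hdom := (hint k).const_mul (2 ^ n)
  refine ⟨hdom.mono' hm.aestronglyMeasurable (ae_of_all _ fun ω => ?_), ?_⟩
  · rw [Real.norm_of_nonneg (by positivity)]
    exact hpt ω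
  · refine (integral_mono_of_nonneg (ae_of_all _ fun ω => ?_) hdom (ae_of_all _ hpt)).trans ?_
    · exact pow_nonneg (by positivity) _
    · rw [integral_const_mul]
      gcongr
      exact hmoment k

end Chain

/-! ### Second-moment calculus and summation by parts. -/

section SquareIntegrable

variable {Ω : Type*} {mΩ : MeasurableSpace Ω} {P : Measure Ω}

/-- `X` is measurable with second moment at most `c`. -/
structure SqBound (P : Measure Ω) (X : Ω → ℝ) (c : ℝ) : Prop where
  measurable : AEStronglyMeasurable X P
  integrable : Integrable (fun ω => X ω ^ 2) P
  le : ∫ ω, X ω ^ 2 ∂P ≤ c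

lemma SqBound.nonneg {X : Ω → ℝ} {c : ℝ} (h : SqBound P X c) : 0 ≤ c :=
  (integral_nonneg fun ω => sq_nonneg (X ω)).trans h.le

lemma SqBound.of_sq_le {X Z : Ω → ℝ} {c : ℝ} (hX : AEStronglyMeasurable X P)
    (hZ : Integrable Z P) (h : ∀ ω, X ω ^ 2 ≤ Z ω) (hc : ∫ ω, Z ω ∂P ≤ c) : SqBound P X c := by
  refine ⟨hX, hZ.mono' (hX.pow 2) (ae_of_all _ fun ω => ?_), le_trans ?_ hc⟩
  · rw [Real.norm_of_nonneg (sq_nonneg _)]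
    exact h ω
  · exact integral_mono_of_nonneg (ae_of_all _ fun ω => sq_nonneg _) hZ (ae_of_all _ h)

/-- Weighted Cauchy–Schwarz, `(∑ w X)² ≤ (∑ w)(∑ w X²)`; no independence is involved, whence the
square of the total weight. -/
lemma SqBound.weighted_sum {w : ℕ → ℝ} (hw : ∀ i, 0 ≤ w i) {X : ℕ → Ω → ℝ} {c : ℝ}
    (hX : ∀ i, SqBound P (X i) c) (s : Finset ℕ) :
    SqBound P (fun ω => ∑ i ∈ s, w i * X i ω) ((∑ i ∈ s, w i) ^ 2 * c) := by
  have hW : 0 ≤ ∑ i ∈ s, w i := Finset.sum_nonneg fun i _ => hw i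
  refine SqBound.of_sq_le (Z := fun ω => (∑ i ∈ s, w i) * ∑ i ∈ s, w i * X i ω ^ 2)
    (Finset.aestronglyMeasurable_fun_sum _ fun i _ => (hX i).measurable.const_mul _)
    ((integrable_finsetSum _ fun i _ => (hX i).integrable.const_mul _).const_mul _)
    (fun ω => ?_) ?_
  · exact Finset.sum_sq_le_sum_mul_sum_of_sq_le_mul s (fun i _ => hw i)
      (fun i _ => mul_nonneg (hw i) (sq_nonneg _)) (fun i _ => le_of_eq (by ring))
  · rw [integral_const_mul, integral_finsetSum _ fun i _ => (hX i).integrable.const_mul _]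
    simp only [integral_const_mul]
    calc _ ≤ (∑ i ∈ s, w i) * ∑ i ∈ s, w i * c := by
          gcongr with i
          · exact hw i
          · exact (hX i).le
      _ = _ := by rw [← Finset.sum_mul]; ring

lemma SqBound.const_mul {X : Ω → ℝ} {c : ℝ} (hX : SqBound P X c) (a : ℝ) :
    SqBound P (fun ω => a * X ω) (a ^ 2 * c) := by
  refine SqBound.of_sq_le (hX.measurable.const_mul a) (hX.integrable.const_mul (a ^ 2))
    (fun ω => (mul_pow a _ 2).le) ?_
  rw [integral_const_mul]
  exact mul_le_mul_of_nonneg_left hX.le (sq_nonneg a)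

lemma SqBound.add_add {X Y Z : Ω → ℝ} {a b c : ℝ} (hX : SqBound P X a) (hY : SqBound P Y b)
    (hZ : SqBound P Z c) : SqBound P (fun ω => X ω + Y ω + Z ω) (3 * (a + b + c)) := by
  have hi := (hX.integrable.add hY.integrable).add hZ.integrable
  refine SqBound.of_sq_le ((hX.measurable.add hY.measurable).add hZ.measurable)
    (hi.const_mul 3) (fun ω => ?_) ?_
  · simp only [Pi.add_apply]
    nlinarith [sq_nonneg (X ω - Y ω), sq_nonneg (X ω - Z ω), sq_nonneg (Y ω - Z ω)]
  · rw [integral_const_mul, integral_add' (hX.integrable.add hY.integrable) hZ.integrable,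
      integral_add' hX.integrable hY.integrable]
    linarith [hX.le, hY.le, hZ.le]

lemma SqBound.mono {X : Ω → ℝ} {a c : ℝ} (hX : SqBound P X a) (h : a ≤ c) : SqBound P X c :=
  ⟨hX.measurable, hX.integrable, hX.le.trans h⟩

lemma SqBound.memLp {X : Ω → ℝ} {c : ℝ} (hX : SqBound P X c) : MemLp X 2 P :=
  (memLp_two_iff_integrable_sq hX.measurable).2 hX.integrable

/-- Summation by parts. -/
lemma sum_range_succ_mul_sub (w F : ℕ → ℝ) (M : ℕ) :
    ∑ k ∈ Finset.range (M + 1), w k * (F (k + 1) - F k)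
      = w M * F (M + 1) + (-w 0) * F 0
        + ∑ k ∈ Finset.range M, (w k - w (k + 1)) * F (k + 1) := by
  induction M with
  | zero => simp; ring
  | succ M ih => rw [Finset.sum_range_succ, ih, Finset.sum_range_succ]; ring

/-- Weighted increments of an `L²`-bounded sequence, with decreasing weights. -/
lemma SqBound.weighted_increments {w : ℕ → ℝ} (hw : ∀ i, 0 ≤ w i) (hwa : Antitone w)
    {F : ℕ → Ω → ℝ} {c : ℝ} (hF : ∀ i, SqBound P (F i) c) (M : ℕ) :
    SqBound P (fun ω => ∑ k ∈ Finset.range M, w k * (F (k + 1) ω - F k ω))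
      (9 * w 0 ^ 2 * c) := by
  have hc : 0 ≤ c := (hF 0).nonneg
  cases M with
  | zero =>
    simp only [Finset.range_zero, Finset.sum_empty]
    refine ⟨aestronglyMeasurable_const, by simp, ?_⟩
    simp only [ne_eq, OfNat.ofNat_ne_zero, not_false_eq_true, zero_pow, integral_zero]
    positivity
  | succ M =>
    have hd : ∀ i, 0 ≤ w i - w (i + 1) := fun i => sub_nonneg.2 (hwa i.le_succ)
    -- The new weights `w i - w (i + 1)` are nonnegative with total `w 0 - w M ≤ w 0`, so nothing
    -- grows with `M`. The two boundary terms and this sum each contribute `w 0 ^ 2 * c`, and the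
    -- three-term square inequality supplies the other factor `3` of the `9`.
    have h3 := SqBound.weighted_sum hd (fun i => hF (i + 1)) (Finset.range M)
    have h := ((hF (M + 1)).const_mul (w M)).add_add ((hF 0).const_mul (-w 0)) h3
    have e : (fun ω => ∑ k ∈ Finset.range (M + 1), w k * (F (k + 1) ω - F k ω))
        = fun ω => w M * F (M + 1) ω + (-w 0) * F 0 ω
          + ∑ k ∈ Finset.range M, (w k - w (k + 1)) * F (k + 1) ω :=
      funext fun ω => sum_range_succ_mul_sub w (fun k => F k ω) M
    rw [e]
    refine h.mono ?_
    rw [Finset.sum_range_sub']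
    have h1 : w M ^ 2 ≤ w 0 ^ 2 := by
      have := hw M
      gcongr
      exact hwa (Nat.zero_le _)
    have h2 : (w 0 - w M) ^ 2 ≤ w 0 ^ 2 := by
      have := hwa (Nat.zero_le M)
      gcongr
      linarith [hw M]
    calc 3 * (w M ^ 2 * c + (-w 0) ^ 2 * c + (w 0 - w M) ^ 2 * c)
        ≤ 3 * (w 0 ^ 2 * c + (-w 0) ^ 2 * c + w 0 ^ 2 * c) := by gcongr
      _ = _ := by ring

end SquareIntegrable

/-! ### Orthogonality of martingale increments. -/

section MartingaleSum

variable {d : ℕ} {Ω : Type*} {mΩ : MeasurableSpace Ω} {P : Measure Ω} [IsProbabilityMeasure P]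
  {U : ℕ → Ω → Vec d}

/-- Orthogonality of the martingale increments of the scheme. -/
lemma IsGaussianNoise.sqBound_martingale_sum (hU : IsGaussianNoise U P) {Y : ℕ → Ω → Vec d}
    (hY : ∀ k, Measurable[past U k] (Y k)) {p : ℕ} {m : ℝ}
    (hYi : ∀ k, Integrable (fun ω => (1 + ‖Y k ω‖) ^ (2 * p)) P)
    (hYm : ∀ k, ∫ ω, (1 + ‖Y k ω‖) ^ (2 * p) ∂P ≤ m)
    {G : ℕ → Vec d × Vec d → ℝ} (hG : ∀ k, Measurable (G k))
    (hG0 : ∀ k y, ∫ u, G k (y, u) ∂(stdGaussian (Vec d)) = 0) {v : ℕ → ℝ} {C : ℝ}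
    (hGb : ∀ k y u, G k (y, u) ^ 2 ≤ v k * (C * ((1 + ‖y‖) * (1 + ‖u‖)) ^ (2 * p)))
    (hC : 0 ≤ C) (hv : ∀ k, 0 ≤ v k) (w : ℕ → ℝ) (M : ℕ) :
    SqBound P (fun ω => ∑ k ∈ Finset.range M, w k * G k (Y k ω, U k ω))
      (C * m * gaussMoment d (2 * p) * ∑ k ∈ Finset.range M, w k ^ 2 * v k) := by
  have hYmeas : ∀ k, Measurable (Y k) := fun k => (hY k).mono (hU.past_le k) le_rfl
  have hsq : ∀ k, SqBound P (fun ω => G k (Y k ω, U k ω))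
      (v k * (C * m * gaussMoment d (2 * p))) := by
    intro k
    obtain ⟨hi, hle⟩ := integrable_indep_of_bound (hYmeas k) (hU.law k)
      (hU.indepFun_of_past (hY k)) ((hG k).pow_const 2)
      (w := fun y => v k * C * (1 + ‖y‖) ^ (2 * p)) (by fun_prop) ((hYi k).const_mul _)
      (n := 2 * p) (fun y u => by
        rw [abs_of_nonneg (sq_nonneg _)]
        refine (hGb k y u).trans_eq ?_
        rw [mul_pow]
        ring)
    refine ⟨((hG k).comp ((hYmeas k).prodMk (hU.measurable k))).aestronglyMeasurable, hi,
      (le_abs_self _).trans (hle.trans ?_)⟩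
    rw [integral_const_mul]
    have := gaussMoment_nonneg d (2 * p)
    have := hv k
    calc _ ≤ v k * C * m * gaussMoment d (2 * p) := by gcongr; exact hYm k
      _ = _ := by ring
  -- Measurability with respect to the past is carried through the induction: it makes the partial
  -- sum, jointly with `Y M`, independent of `U M`.
  suffices h : Measurable[past U M] (fun ω => ∑ k ∈ Finset.range M, w k * G k (Y k ω, U k ω)) ∧
      SqBound P (fun ω => ∑ k ∈ Finset.range M, w k * G k (Y k ω, U k ω))
      (C * m * gaussMoment d (2 * p) * ∑ k ∈ Finset.range M, w k ^ 2 * v k) from h.2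
  induction M with
  | zero =>
    refine ⟨by simp, ?_⟩
    simp only [Finset.range_zero, Finset.sum_empty, mul_zero]
    exact ⟨aestronglyMeasurable_const, by simp, by simp⟩
  | succ M ih =>
    obtain ⟨ihm, ih⟩ := ih
    set N : Ω → ℝ := fun ω => ∑ k ∈ Finset.range M, w k * G k (Y k ω, U k ω) with hN
    set D : Ω → ℝ := fun ω => G M (Y M ω, U M ω) with hD
    have hNm : Measurable N := ihm.mono (hU.past_le M) le_rfl
    simp only [Finset.sum_range_succ]
    refine ⟨?_, ?_⟩
    · have h1 : Measurable[past U (M + 1)] N := ihm.mono (past_mono U M.le_succ) le_rfl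
      have h2 : Measurable[past U (M + 1)] D := (hG M).comp
        (((hY M).mono (past_mono U M.le_succ) le_rfl).prodMk (measurable_past_succ U M))
      exact h1.add (h2.const_mul (w M))
    · have hND : Integrable (fun ω => N ω * D ω) P := ih.memLp.integrable_mul (hsq M).memLp
      -- Integrating out `U M` first, with the pair `(N, Y M)` frozen, kills the cross term because
      -- `G M` is centred in its noise variable.
      have hND0 : ∫ ω, N ω * D ω ∂P = 0 := by
        have hpair : Measurable[past U M] fun ω => (N ω, Y M ω) := ihm.prodMk (hY M)
        have := integral_indep_stdGaussian (P := P) (hNm.prodMk (hYmeas M)) (hU.law M)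
          (hU.indepFun_of_past hpair) (g := fun z : (ℝ × Vec d) × Vec d => z.1.1 * G M (z.1.2, z.2))
          (by have := hG M; fun_prop) hND
        simp only [integral_const_mul, hG0, mul_zero, integral_zero] at this
        exact this
      have e : ∀ ω, (N ω + w M * D ω) ^ 2
          = N ω ^ 2 + 2 * w M * (N ω * D ω) + w M ^ 2 * D ω ^ 2 := fun ω => by ring
      have hi1 : Integrable (fun ω => N ω ^ 2 + 2 * w M * (N ω * D ω)) P :=
        ih.integrable.add (hND.const_mul _)
      have hi2 : Integrable (fun ω => w M ^ 2 * D ω ^ 2) P := (hsq M).integrable.const_mul _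
      refine ⟨ih.measurable.add ((hsq M).measurable.const_mul _), ?_, ?_⟩
      · change Integrable (fun ω => (N ω + w M * D ω) ^ 2) P
        simp only [e]
        exact hi1.add hi2
      · change ∫ ω, (N ω + w M * D ω) ^ 2 ∂P ≤ _
        simp only [e]
        rw [integral_add hi1 hi2, integral_add ih.integrable (hND.const_mul _),
          integral_const_mul, integral_const_mul, hND0]
        have h1 := ih.le
        have h2 := mul_le_mul_of_nonneg_left (hsq M).le (sq_nonneg (w M))
        linarith

end MartingaleSum

/-! ### Weighted sums of the generator: the three-term decomposition. -/

section ErgodicAverage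

variable {d : ℕ} {Ω : Type*} {mΩ : MeasurableSpace Ω}

lemma sum_Icc_one_eq_sum_range {A : Type*} [AddCommMonoid A] (F : ℕ → A) (M : ℕ) :
    ∑ k ∈ Finset.Icc 1 M, F k = ∑ k ∈ Finset.range M, F (k + 1) := by
  rw [Finset.range_eq_Ico, Finset.sum_Ico_add' F 0 M 1]
  rfl

lemma powSum_eq_sum_range (γ : ℕ → ℝ) (p : ℝ) (M : ℕ) :
    powSum γ p M = ∑ k ∈ Finset.range M, γ (k + 1) ^ p :=
  sum_Icc_one_eq_sum_range (fun k => γ k ^ p) M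

lemma measurable_generator {b : Vec d → Vec d} {σ : Vec d → Matrix (Fin d) (Fin d) ℝ}
    (hb : Continuous b) (hσ : ∀ i j, Measurable fun y => σ y i j) {f : Vec d → ℝ}
    (hf : ContDiff ℝ 4 f) :
    Measurable (generator b (fun y => σ y * (σ y).transpose) f) := by
  have h2 : Continuous (iteratedFDeriv ℝ 2 f) := hf.continuous_iteratedFDeriv (by norm_num)
  have h1 : Continuous (fderiv ℝ f) := hf.continuous_fderiv (by norm_num)
  have hbi : ∀ i, Measurable fun y => b y i := fun i =>
    ((EuclideanSpace.proj (𝕜 := ℝ) i).continuous.comp hb).measurable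
  have ha : ∀ i j, Measurable fun y => (σ y * (σ y).transpose) i j := fun i j => by
    simp only [Matrix.mul_apply, Matrix.transpose_apply]
    exact Finset.measurable_sum _ fun k _ => (hσ i k).mul (hσ j k)
  have h2' : ∀ v, Measurable fun y => iteratedFDeriv ℝ 2 f y v := fun v =>
    (h2.eval_const v).measurable
  have h1' : ∀ v, Measurable fun y => fderiv ℝ f y v := fun v => (h1.clm_apply
    continuous_const).measurable
  unfold generator
  refine (Measurable.const_mul (Finset.measurable_sum _ fun i _ => Finset.measurable_sum _
    fun j _ => (ha i j).mul (h2' _)) _).add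
    (Finset.measurable_sum _ fun i _ => (hbi i).mul (h1' _))

/-- The mean square size of the weighted sums of `L f` along the scheme. -/
theorem exists_sqBound_sum_generator (P : Measure Ω) [IsProbabilityMeasure P] {B S K c₁ : ℝ}
    (c₂ : ℝ) (hB : 0 ≤ B) (hS : 0 ≤ S) (hK : 0 ≤ K) (hc₁ : 0 < c₁) {γ : ℕ → ℝ}
    (hγ : ∀ k, 0 < γ k) (hγa : Antitone γ) (hγ0 : Tendsto γ atTop (𝓝 0)) (y₀ : Vec d) (m : ℕ)
    {α : ℝ} (hα : 1 ≤ α) :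
    ∃ C, 0 ≤ C ∧ ∀ (b : Vec d → Vec d) (σ : Vec d → Matrix (Fin d) (Fin d) ℝ)
      (U : ℕ → Ω → Vec d) (f : Vec d → ℝ), IsGaussianNoise U P → Continuous b →
      (∀ i j, Measurable fun y => σ y i j) → CoeffBound B S b σ →
      (∀ y, inner ℝ (b y) y ≤ -c₁ * ‖y‖ ^ 2 + c₂) → PolyDeriv K m f → ∀ M,
      SqBound P (fun ω => ∑ k ∈ Finset.range M, γ (k + 1) ^ α *
          generator b (fun y => σ y * (σ y).transpose) f (chain b σ γ U y₀ k ω))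
        (C * (1 + powSum γ (2 * α - 1) M + powSum γ (α + 1) M ^ 2)) := by
  -- The three exponents are twice the growth exponents of `f`, of its increment and of the weak
  -- error, which serve the telescoping, martingale and remainder parts respectively.
  obtain ⟨M₁, hM₁, hm₁⟩ := exists_moment_bound (B := B) (S := S) P c₂ hB hS hc₁ hγ hγa hγ0 y₀
    (2 * m)
  obtain ⟨M₂, hM₂, hm₂⟩ := exists_moment_bound (B := B) (S := S) P c₂ hB hS hc₁ hγ hγa hγ0 y₀
    (2 * (m + 1))
  obtain ⟨M₃, hM₃, hm₃⟩ := exists_moment_bound (B := B) (S := S) P c₂ hB hS hc₁ hγ hγa hγ0 y₀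
    (2 * (m + 4))
  obtain ⟨g, hgdef⟩ : ∃ g, g = γ 0 := ⟨_, rfl⟩
  have hγg : ∀ k, γ k ≤ g := fun k => hgdef ▸ hγa (Nat.zero_le k)
  obtain ⟨A₂, hA₂⟩ : ∃ A₂, A₂ = K * (1 + √g * (√g * B + S)) ^ m * (√g * B + S) := ⟨_, rfl⟩
  obtain ⟨A₃, hA₃⟩ : ∃ A₃, A₃ = (S ^ 4 + B ^ 2 + B * S ^ 2) * (K * (1 + √g * (√g * B + S)) ^ m)
    * gaussMoment d (m + 4) := ⟨_, rfl⟩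
  obtain ⟨D₂, hD₂⟩ : ∃ D₂, D₂ = A₂ * (1 + gaussMoment d (m + 1)) := ⟨_, rfl⟩
  have hA₂0 : 0 ≤ A₂ := by rw [hA₂]; positivity
  have hgm := gaussMoment_nonneg d (m + 1)
  have hgm' := gaussMoment_nonneg d (m + 4)
  have hgm'' := gaussMoment_nonneg d (2 * (m + 1))
  have hA₃0 : 0 ≤ A₃ := by rw [hA₃]; positivity
  have hD₂0 : 0 ≤ D₂ := by rw [hD₂]; positivity
  obtain ⟨w, hw⟩ : ∃ w : ℕ → ℝ, w = fun k => γ (k + 1) ^ (α - 1) := ⟨_, rfl⟩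
  have hw0 : ∀ k, 0 ≤ w k := fun k => by rw [hw]; exact Real.rpow_nonneg (hγ _).le _
  -- This is where `α ≥ 1` enters: the exponent `α - 1` is nonnegative, so the weights inherit the
  -- monotonicity of the steps.
  have hwa : Antitone w := by
    intro j k hjk
    rw [hw]
    exact Real.rpow_le_rpow (hγ _).le (hγa (Nat.succ_le_succ hjk)) (by linarith)
  refine ⟨3 * (9 * w 0 ^ 2 * (K ^ 2 * M₁) + D₂ ^ 2 * M₂ * gaussMoment d (2 * (m + 1))
    + A₃ ^ 2 * M₃), by positivity, fun b σ U f hU hb hσ hbσ hdiss hf M => ?_⟩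
  set Lf : Vec d → ℝ := generator b (fun y => σ y * (σ y).transpose) f with hLf
  set Y : ℕ → Ω → Vec d := chain b σ γ U y₀ with hYdef
  have hYp : ∀ k, Measurable[past U k] (Y k) := measurable_past_chain hb hσ y₀
  have hYm : ∀ k, Measurable (Y k) := hU.measurable_chain hb hσ y₀
  have hLfm : Measurable Lf := measurable_generator hb hσ hf.contDiff
  have hfm : Measurable f := hf.contDiff.continuous.measurable
  set T : ℕ → Vec d × Vec d → ℝ := fun k p => f (eulerStep b σ (γ (k + 1)) p.1 p.2) - f p.1
    with hT
  have hTm : ∀ k, Measurable (T k) := fun k =>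
    (hfm.comp (measurable_eulerStep hb hσ _)).sub (hfm.comp measurable_fst)
  have hTb : ∀ k y u, |T k (y, u)| ≤
      √(γ (k + 1)) * (A₂ * ((1 + ‖y‖) * (1 + ‖u‖)) ^ (m + 1)) := fun k y u => by
    rw [hA₂]
    exact hf.abs_eulerStep_sub_le hK hbσ (hγ _).le (hγg _) y u
  have hTi : ∀ k y, Integrable (fun u => T k (y, u)) (stdGaussian (Vec d)) := fun k y =>
    hf.integrable_eulerStep_sub hK hbσ (hγ _).le y
  set R : ℕ → Vec d → ℝ := fun k y => ∫ u, T k (y, u) ∂(stdGaussian (Vec d)) with hR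
  have hRm : ∀ k, Measurable (R k) := fun k =>
    (hTm k).stronglyMeasurable.integral_prod_right'.measurable
  have hRb : ∀ k y, |R k y| ≤
      √(γ (k + 1)) * (A₂ * gaussMoment d (m + 1) * (1 + ‖y‖) ^ (m + 1)) := fun k y => by
    refine (abs_integral_stdGaussian_le (C := √(γ (k + 1)) * (A₂ * (1 + ‖y‖) ^ (m + 1)))
      (n := m + 1) fun u => (hTb k y u).trans_eq ?_).trans_eq ?_
    · rw [mul_pow]; ring
    · ring
  have hRL : ∀ k y, |R k y - γ (k + 1) * Lf y| ≤ γ (k + 1) ^ 2 * (A₃ * (1 + ‖y‖) ^ (m + 4)) :=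
    fun k y => by
      rw [hA₃]
      exact hf.abs_weak_error_le hK hbσ (hγ _).le (hγg _) y
  -- the telescoping part
  have hF : ∀ k, SqBound P (fun ω => f (Y k ω)) (K ^ 2 * M₁) := fun k => by
    obtain ⟨hi, hle⟩ := hm₁ b σ U hU hb hσ hbσ hdiss k
    refine SqBound.of_sq_le (hfm.comp (hYm k)).aestronglyMeasurable (hi.const_mul (K ^ 2))
      (fun ω => ?_) ?_
    · rw [← sq_abs, pow_mul', ← mul_pow]
      gcongr
      exact hf.abs_le _
    · rw [integral_const_mul]
      gcongr
  have part₁ := SqBound.weighted_increments hw0 hwa hF M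
  -- the martingale part
  have part₂ := hU.sqBound_martingale_sum hYp (p := m + 1) (m := M₂)
    (fun k => (hm₂ b σ U hU hb hσ hbσ hdiss k).1) (fun k => (hm₂ b σ U hU hb hσ hbσ hdiss k).2)
    (G := fun k p => T k p - R k p.1) (fun k => (hTm k).sub ((hRm k).comp measurable_fst))
    (fun k y => by
      change ∫ u, (T k (y, u) - R k y) ∂(stdGaussian (Vec d)) = 0
      rw [integral_sub (hTi k y) (integrable_const _)]
      simp [hR])
    (v := fun k => γ (k + 1)) (C := D₂ ^ 2) (fun k y u => by
      have hb : |T k (y, u) - R k y| ≤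
          √(γ (k + 1)) * (D₂ * ((1 + ‖y‖) * (1 + ‖u‖)) ^ (m + 1)) := by
        have h1 : (1 + ‖y‖) ^ (m + 1) ≤ ((1 + ‖y‖) * (1 + ‖u‖)) ^ (m + 1) := by
          gcongr
          exact le_mul_of_one_le_right (by positivity) (by linarith [norm_nonneg u])
        calc _ ≤ |T k (y, u)| + |R k y| := abs_sub _ _
          _ ≤ √(γ (k + 1)) * (A₂ * ((1 + ‖y‖) * (1 + ‖u‖)) ^ (m + 1))
              + √(γ (k + 1)) * (A₂ * gaussMoment d (m + 1)
                * ((1 + ‖y‖) * (1 + ‖u‖)) ^ (m + 1)) := by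
              refine add_le_add (hTb k y u) ((hRb k y).trans ?_)
              gcongr
          _ = _ := by rw [hD₂]; ring
      rw [← sq_abs]
      calc _ ≤ (√(γ (k + 1)) * (D₂ * ((1 + ‖y‖) * (1 + ‖u‖)) ^ (m + 1))) ^ 2 := by gcongr
        _ = _ := by
          rw [mul_pow, Real.sq_sqrt (hγ _).le, mul_pow D₂, pow_mul' _ 2])
    (by positivity) (fun k => (hγ _).le) (fun k => -w k) M
  -- the weak error part
  have hE : ∀ k, SqBound P (fun ω => -((γ (k + 1) ^ 2)⁻¹ *
      (R k (Y k ω) - γ (k + 1) * Lf (Y k ω)))) (A₃ ^ 2 * M₃) := fun k => by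
    obtain ⟨hi, hle⟩ := hm₃ b σ U hU hb hσ hbσ hdiss k
    have hpos : 0 < γ (k + 1) ^ 2 := pow_pos (hγ _) 2
    refine SqBound.of_sq_le ((((hRm k).comp (hYm k)).sub ((hLfm.comp (hYm k)).const_mul
      _)).const_mul _).neg.aestronglyMeasurable (hi.const_mul (A₃ ^ 2)) (fun ω => ?_) ?_
    · rw [neg_sq, ← sq_abs, pow_mul' _ 2, ← mul_pow]
      gcongr
      rw [abs_mul, abs_of_pos (inv_pos.2 hpos), inv_mul_le_iff₀ hpos]
      exact hRL k _
    · rw [integral_const_mul]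
      gcongr
  have part₃ := SqBound.weighted_sum (w := fun k => γ (k + 1) ^ (α + 1))
    (fun k => Real.rpow_nonneg (hγ _).le _) hE (Finset.range M)
  have hsum := (part₁.add_add part₂ part₃)
  have hdecomp : (fun ω => ∑ k ∈ Finset.range M, γ (k + 1) ^ α * Lf (Y k ω)) = fun ω =>
      ∑ k ∈ Finset.range M, w k * (f (Y (k + 1) ω) - f (Y k ω))
      + ∑ k ∈ Finset.range M, -w k * (T k (Y k ω, U k ω) - R k (Y k ω))
      + ∑ k ∈ Finset.range M, γ (k + 1) ^ (α + 1) * -((γ (k + 1) ^ 2)⁻¹ *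
        (R k (Y k ω) - γ (k + 1) * Lf (Y k ω))) := by
    funext ω
    rw [← Finset.sum_add_distrib, ← Finset.sum_add_distrib]
    refine Finset.sum_congr rfl fun k _ => ?_
    have hp := hγ (k + 1)
    have e1 : T k (Y k ω, U k ω) = f (Y (k + 1) ω) - f (Y k ω) := rfl
    have e2 : γ (k + 1) ^ α = w k * γ (k + 1) := by
      rw [hw]
      change _ = γ (k + 1) ^ (α - 1) * γ (k + 1)
      rw [← Real.rpow_add_one hp.ne']
      ring_nf
    have e3 : γ (k + 1) ^ (α + 1) = w k * γ (k + 1) ^ 2 := by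
      rw [Real.rpow_add_one hp.ne', e2]
      ring
    rw [e1, e2, e3]
    have hne := hp.ne'
    field_simp
    ring
  rw [hdecomp]
  refine hsum.mono ?_
  have e4 : ∑ k ∈ Finset.range M, (-w k) ^ 2 * γ (k + 1) = powSum γ (2 * α - 1) M := by
    rw [powSum_eq_sum_range]
    refine Finset.sum_congr rfl fun k _ => ?_
    have hp := hγ (k + 1)
    rw [neg_sq, hw]
    change (γ (k + 1) ^ (α - 1)) ^ 2 * _ = _
    rw [← Real.rpow_mul_natCast hp.le, ← Real.rpow_add_one hp.ne']
    congr 1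
    push_cast
    ring
  have hpow : ∀ p, 0 ≤ powSum γ p M := fun p =>
    Finset.sum_nonneg fun k _ => Real.rpow_nonneg (hγ k).le _
  rw [e4, ← powSum_eq_sum_range]
  obtain ⟨X, hX⟩ : ∃ X, X = powSum γ (2 * α - 1) M := ⟨_, rfl⟩
  obtain ⟨Z, hZ⟩ : ∃ Z, Z = powSum γ (α + 1) M ^ 2 := ⟨_, rfl⟩
  obtain ⟨a₁, ha₁⟩ : ∃ a₁, a₁ = 9 * w 0 ^ 2 * (K ^ 2 * M₁) := ⟨_, rfl⟩
  obtain ⟨a₂, ha₂⟩ : ∃ a₂, a₂ = D₂ ^ 2 * M₂ * gaussMoment d (2 * (m + 1)) := ⟨_, rfl⟩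
  obtain ⟨a₃, ha₃⟩ : ∃ a₃, a₃ = A₃ ^ 2 * M₃ := ⟨_, rfl⟩
  have hX0 : 0 ≤ X := hX ▸ hpow _
  have hZ0 : 0 ≤ Z := hZ ▸ sq_nonneg _
  have ha₁0 : 0 ≤ a₁ := by rw [ha₁]; positivity
  have ha₂0 : 0 ≤ a₂ := by rw [ha₂]; positivity
  have ha₃0 : 0 ≤ a₃ := by rw [ha₃]; positivity
  rw [← hX, ← hZ, ← ha₁, ← ha₂, ← ha₃]
  -- The bound `a₁ + a₂ X + a₃ Z ≤ (a₁ + a₂ + a₃)(1 + X + Z)` amounts to discarding nonnegative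
  -- terms, these products among them.
  have := mul_nonneg ha₁0 hX0
  have := mul_nonneg ha₁0 hZ0
  have := mul_nonneg ha₂0 hZ0
  have := mul_nonneg ha₃0 hX0
  linarith

end ErgodicAverage

/-! ### From Brownian increments to Gaussian noise. -/

section Noise

variable {d : ℕ} {Ω : Type*} {mΩ : MeasurableSpace Ω} {P : Measure Ω}

lemma hasLaw_noise {γ : ℕ → ℝ} (hγ : ∀ k, 0 < γ k) {W : ℝ≥0 → Ω → Vec d}
    (hW : IsBrownianMotion W P) (k : ℕ) : HasLaw (noise γ W k) (stdGaussian (Vec d)) P := by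
  have hpos : ∀ k, 0 ≤ cumStep γ k := fun k => Finset.sum_nonneg fun j _ => (hγ j).le
  have hsucc : cumStep γ (k + 1) = cumStep γ k + γ (k + 1) := Finset.sum_range_succ _ _
  have hlaw := hW.law (cumStep γ k).toNNReal (cumStep γ (k + 1)).toNNReal
    (Real.toNNReal_mono (by linarith [hγ (k + 1)]))
  rw [Real.coe_toNNReal _ (hpos _), Real.coe_toNNReal _ (hpos _), hsucc, add_sub_cancel_left,
    ← hsucc] at hlaw
  have hm : Measurable fun z : Vec d => (√(γ (k + 1)))⁻¹ • z := measurable_const_smul _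
  have hm' : Measurable fun z : Vec d => √(γ (k + 1)) • z := measurable_const_smul _
  refine ⟨hm.comp_aemeasurable hlaw.aemeasurable, ?_⟩
  have h1 := AEMeasurable.map_map_of_aemeasurable (μ := P) hm.aemeasurable hlaw.aemeasurable
  rw [hlaw.map_eq, Measure.map_map hm hm'] at h1
  have h2 : (fun z : Vec d => (√(γ (k + 1)))⁻¹ • z) ∘ (fun z => √(γ (k + 1)) • z) = id := by
    funext z
    simp [smul_smul, inv_mul_cancel₀ (Real.sqrt_pos.2 (hγ (k + 1))).ne']
  rw [h2, Measure.map_id] at h1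
  exact h1.symm

lemma iIndepFun_noise {γ : ℕ → ℝ} (hγ : ∀ k, 0 < γ k) {W : ℝ≥0 → Ω → Vec d}
    (hW : IsBrownianMotion W P) : iIndepFun (noise γ W) P := by
  have hmono : Monotone fun k => (cumStep γ k).toNNReal :=
    monotone_nat_of_le_succ fun k => Real.toNNReal_mono (by
      have hsucc : cumStep γ (k + 1) = cumStep γ k + γ (k + 1) := Finset.sum_range_succ _ _
      linarith [hγ (k + 1)])
  exact (hW.indep.nat hmono).comp (fun k z => (√(γ (k + 1)))⁻¹ • z)
    fun k => measurable_const_smul _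

/-- The Euler scheme driven by a Brownian motion is almost surely the chain driven by a Gaussian
noise. -/
lemma exists_chain_ae_eq_euler {γ : ℕ → ℝ} (hγ : ∀ k, 0 < γ k) {W : ℝ≥0 → Ω → Vec d}
    (hW : IsBrownianMotion W P) :
    ∃ U : ℕ → Ω → Vec d, IsGaussianNoise U P ∧
      ∀ (b : Vec d → Vec d) (σ : Vec d → Matrix (Fin d) (Fin d) ℝ) (y₀ : Vec d),
        ∀ᵐ ω ∂P, ∀ k, euler b σ γ W y₀ k ω = chain b σ γ U y₀ k ω := by
  have hlaw := hasLaw_noise hγ hW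
  have hae : ∀ k, noise γ W k =ᵐ[P] (hlaw k).aemeasurable.mk (noise γ W k) := fun k =>
    (hlaw k).aemeasurable.ae_eq_mk
  -- The Brownian increments are known to be measurable only almost everywhere, whereas the
  -- σ-algebras `past` need measurable maps; countably many modifications change the scheme only on
  -- a null set.
  refine ⟨fun k => (hlaw k).aemeasurable.mk (noise γ W k),
    ⟨fun k => (hlaw k).aemeasurable.measurable_mk, fun k => (hlaw k).congr (hae k).symm,
      (iIndepFun_noise hγ hW).congr hae⟩, fun b σ y₀ => ?_⟩
  filter_upwards [ae_all_iff.2 hae] with ω hω k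
  induction k with
  | zero => rfl
  | succ k ih => rw [euler, chain, ih, eulerStep, hω k]

end Noise

/-! ### Extracting constants uniform in `x`. -/

section Hypotheses

variable {dx dy : ℕ} {b : Vec dx → Vec dy → Vec dy}
  {σ : Vec dx → Vec dy → Matrix (Fin dy) (Fin dy) ℝ}

lemma FastScaleHypothesis.exists_coeffBound (h : FastScaleHypothesis b σ) :
    ∃ B S : ℝ, 0 ≤ B ∧ 0 ≤ S ∧ ∀ x, CoeffBound B S (b x) (σ x) := by
  obtain ⟨K, hK⟩ := h.regular_drift.2.2
  obtain ⟨lo, hi, -, hhi, hell⟩ := h.elliptic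
  refine ⟨|K|, √hi, abs_nonneg _, Real.sqrt_nonneg _, fun x =>
    ⟨abs_nonneg _, Real.sqrt_nonneg _, fun y => ?_, fun y u => ?_⟩⟩
  · have := hK 0 (by norm_num) x y
    rw [norm_iteratedFDeriv_zero] at this
    refine this.trans ?_
    gcongr
    exact le_abs_self K
  · exact norm_toEuclideanLin_le (hell x y).2 hhi.le u

/-- The condition `r > 3` provides exactly the four `y`-derivatives used by the weak error
expansion. The factor `2` comes from `1 + ‖y‖ ^ m ≤ 2 (1 + ‖y‖) ^ m`. -/
lemma ClassC2rbp.exists_polyDeriv {r : ℕ} (hr : 3 < r) {φ : Vec dx → Vec dy → ℝ}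
    (h : ClassC2rbp r φ) : ∃ (K : ℝ) (m : ℕ), 0 ≤ K ∧ ∀ x, PolyDeriv K m (φ x) := by
  obtain ⟨hc, -, K, m, hK⟩ := h
  refine ⟨2 * |K|, m, by positivity, fun x => ⟨(hc x).of_le (by exact_mod_cast hr), ?_⟩⟩
  intro j hj y
  have h1 := hK 0 j (by norm_num) (by omega) x y
  rw [norm_iteratedFDeriv_zero] at h1
  have hy := norm_nonneg y
  have h2 : 1 ≤ (1 + ‖y‖) ^ m := one_le_pow₀ (by linarith)
  have h3 : ‖y‖ ^ m ≤ (1 + ‖y‖) ^ m := by gcongr; linarith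
  calc _ ≤ K * (1 + ‖y‖ ^ m) := h1
    _ ≤ |K| * (1 + ‖y‖ ^ m) := by gcongr; exact le_abs_self K
    _ ≤ |K| * (2 * (1 + ‖y‖) ^ m) := by gcongr; linarith
    _ = _ := by ring

end Hypotheses

end DecreasingStep

theorem mainTheorem8 {dx dy : ℕ}
    {b : Vec dx → Vec dy → Vec dy} {σ : Vec dx → Vec dy → Matrix (Fin dy) (Fin dy) ℝ}
    (hfast : FastScaleHypothesis b σ)
    {μ : Vec dx → Measure (Vec dy)}
    (hμ : ∀ x, IsInvariantMeasure (b x) (diffusionMatrix σ x) (μ x))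
    {γ : ℕ → ℝ} (hγ : StepHypothesis γ)
    {Ω : Type*} {mΩ : MeasurableSpace Ω} {P : Measure Ω} [IsProbabilityMeasure P]
    {W : ℚ → ℝ≥0 → Ω → Vec dy} (hW : ∀ q, IsBrownianMotion (W q) P)
    (y₀ : Vec dy)
    {ψ : Vec dx → Vec dy → ℝ}
    (hψ : ∃ (C : Vec dx → ℝ) (p : ℝ), 0 ≤ p ∧ ∀ x y, |ψ x y| ≤ C x * (1 + ‖y‖ ^ p))
    {φ : Vec dx → Vec dy → ℝ}
    (hφ : ∀ x y, generator (b x) (diffusionMatrix σ x) (φ x) y = ψ x y - ∫ z, ψ x z ∂(μ x))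
    {r : ℕ} (hr : 3 < r) (hφr : ClassC2rbp r φ)
    {α : ℝ} (hα : 1 ≤ α) (hΓα : Tendsto (powSum γ α) atTop atTop) :
    ∃ K : ℝ, ∀ (x : Vec dx) (q : ℚ) (M : ℕ), 1 ≤ M →
      Integrable (fun ω => |1 / powSum γ α M * ∑ k ∈ Finset.Icc 1 M, γ k ^ α *
        (ψ x (euler (b x) (σ x) γ (W q) y₀ (k - 1) ω) - ∫ z, ψ x z ∂(μ x))| ^ 2) P ∧
      ∫ ω, |1 / powSum γ α M * ∑ k ∈ Finset.Icc 1 M, γ k ^ α *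
        (ψ x (euler (b x) (σ x) γ (W q) y₀ (k - 1) ω) - ∫ z, ψ x z ∂(μ x))| ^ 2 ∂P
      ≤ K * ((1 + powSum γ (2 * α - 1) M + powSum γ (2 * α) M + powSum γ (α + 1) M ^ 2)
          / powSum γ α M ^ 2) := by
  obtain ⟨B, S, hB, hS, hbσ⟩ := hfast.exists_coeffBound
  obtain ⟨K, m, hK, hf⟩ := hφr.exists_polyDeriv hr
  obtain ⟨c₁, c₂, hc₁, hdiss⟩ := hfast.recurrent
  -- `C` is fixed before `x`, `q` and `M` are introduced, which is the claimed uniformity; the noise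
  -- `U` may later depend on `q`.
  obtain ⟨C, hC, hbound⟩ := exists_sqBound_sum_generator (B := B) (S := S) (K := K) P c₂ hB hS hK
    hc₁ hγ.pos hγ.decreasing hγ.tendsto_zero y₀ m hα
  refine ⟨C, fun x q M _ => ?_⟩
  obtain ⟨U, hU, hUe⟩ := exists_chain_ae_eq_euler hγ.pos (hW q)
  have hsq := (hbound (b x) (σ x) U (φ x) hU (hfast.regular_drift.1 x) (hfast.measurable_sigma x)
    (hbσ x) (hdiss x) (hf x) M).const_mul (1 / powSum γ α M)
  have hae : (fun ω => |1 / powSum γ α M * ∑ k ∈ Finset.Icc 1 M, γ k ^ α *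
      (ψ x (euler (b x) (σ x) γ (W q) y₀ (k - 1) ω) - ∫ z, ψ x z ∂(μ x))| ^ 2) =ᵐ[P]
      fun ω => (1 / powSum γ α M * ∑ k ∈ Finset.range M, γ (k + 1) ^ α *
        generator (b x) (fun y => σ x y * (σ x y).transpose) (φ x)
          (chain (b x) (σ x) γ U y₀ k ω)) ^ 2 := by
    filter_upwards [hUe (b x) (σ x) y₀] with ω hω
    rw [sq_abs, sum_Icc_one_eq_sum_range]
    congr 2
    refine Finset.sum_congr rfl fun k _ => ?_
    -- The Poisson equation, read from right to left, turns the centred observable into the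
    -- generator of `φ x`; after the shift of index, `k - 1` is no truncated subtraction.
    rw [← hφ, Nat.add_sub_cancel, hω k]
    rfl
  refine ⟨hsq.integrable.congr hae.symm, ?_⟩
  rw [integral_congr_ae hae]
  refine hsq.le.trans ?_
  -- The decomposition produces no `Γ^[2α]` term; being nonnegative, it only enlarges the right-hand
  -- side.
  have h2α : 0 ≤ powSum γ (2 * α) M :=
    Finset.sum_nonneg fun k _ => Real.rpow_nonneg (hγ.pos k).le _
  calc (1 / powSum γ α M) ^ 2 * (C * (1 + powSum γ (2 * α - 1) M + powSum γ (α + 1) M ^ 2))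
      = C * ((1 + powSum γ (2 * α - 1) M + powSum γ (α + 1) M ^ 2) / powSum γ α M ^ 2) := by
        ring
    _ ≤ _ := by
        refine mul_le_mul_of_nonneg_left (div_le_div_of_nonneg_right ?_ (sq_nonneg _)) hC
        linarith
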